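/- **Definitions (algebras).** A partial function on a set $X$ is a set $f\subseteq X\times X$ such that $(x,y),(x,z)\in f$ implies $y=z$. For partial functions $f,g$ on $X$ let $f\,;g=\{(x,z)\mid \exists y:(x,y)\in f,\ (y,z)\in g\}$ (composition), $\mathsf A(f)=\{(x,x)\mid \neg\exists y:(x,y)\in f\}$ (antidomain), $\mathsf R(f)=\{(y,y)\mid \exists x:(x,y)\in f\}$ (range), and $f\sqcup g=f\cup\{(x,y)\in g\mid \neg\exists z:(x,z)\in f\}$ (preferential union). An algebra $(A,;,\mathsf A,\mathsf R,\sqcup)$ with nonempty universe (two binary operations $;$ and $\sqcup$, two unary operations $\mathsf A$ and $\mathsf R$) is *representable by partial functions* if it is isomorphic to a set of partial functions on some set $X$ that is closed under these four operations. Let $\mathscr A$ be the category of such algebras with all homomorphisms. In such an algebra put $\mathsf D(a)=\mathsf A(\mathsf A(a))$, $a\le b\iff \mathsf D(a);b=a$, and $\mathsf D[A]=\{\mathsf A(b)\mid b\in A\}$. A filter of $A$ (or of $\mathsf D[A]$) is a nonempty, upward closed, downward directed subset. A filter $P$ of $A$ is *prime* if $P\ne A$ and $a\sqcup b\in P$ implies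 $a\in P$ or $b\in P$. An ultrafilter of $\mathsf D[A]$ is a maximal proper filter of $\mathsf D[A]$. **Definitions (categories).** A *topological category* is a small category (possibly empty) with topologies on its set of objects $O$ and its set of arrows $M$ such that the source map $\mathbf d:M\to O$, the target map $\mathbf r:M\to O$, the map $x\mapsto 1_x$ and composition $M\times_O M\to M$ are continuous. Composition is written $f\cdot g$ with the first composee on the left. It is a *Stone étale category* if $O$ is compact and totally separated, $\mathbf d$ is a local homeomorphism and $\mathbf r$ is an open map. An arrow $f$ is an epimorphism if $f\cdot g=f\cdot g'$ implies $g=g'$. A *multivalued functor* $F:C\to D$ of topological categories consists of a continuous function $F$ on objects and a relation from the arrows of $C$ to the arrows of $D$ (write $F(f)$ for the set of arrows related to $f$) such that: if $f:x\to y$ and $g\in F(f)$ then $g:F(x)\to F(y)$; $1_{F(x)}\in F(1_x)$; if $f_1\cdot f_2$ is defined and $g_i\in F(f_i)$ then $g_1\cdot g_2\in F(f_1\cdot f_2)$; and $F^{-1}(U)=\{f\mid F(f)\cap U\neq\emptyset\}$ is open for every open set $U$ of arrows of $D$. It is *star coherent* if 1. whenever $f_1,f_2$ have the same source and $F(f_1)\cap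 F(f_2)\ne\emptyset$, then $f_1=f_2$; 2. for every object $x$ of $C$ and every arrow $g$ of $D$ with source $F(x)$ there is an arrow $f$ with source $x$ and $g\in F(f)$; 3. for every object $y$ of $C$ and every open set $U$ of arrows of $D$ containing an arrow with target $F(y)$, there is an arrow $f$ of $C$ with target $y$ and $F(f)\cap U\ne\emptyset$. Multivalued functors are composed as functions on objects and as relations on arrows. Let $\mathscr C$ be the category of Stone étale categories all of whose arrows are epimorphisms, with star-coherent multivalued functors as morphisms. **Theorem.** There is an equivalence of categories $\mathscr A^{\mathrm{op}}\simeq\mathscr C$, given by the following two mutually quasi-inverse functors. * $\mathrm{PF}:\mathscr A^{\mathrm{op}}\to\mathscr C$. The objects of $\mathrm{PF}(A)$ are the ultrafilters of $\mathsf D[A]$ and its arrows are the prime filters of $A$. The source of $P$ is $\mathsf D[P]=\{\mathsf D(a)\mid a\in P\}$; its target is the upward closure of $\{\mathsf R(a)\mid a\in P\}$ in $\mathsf D[A]$. The identity of $\mu$ is the upward closure of $\mu$ in $A$, and $P\cdot Q$ is the upward closure in $A$ of $\{p\,;q\mid p\in P,\ q\in Q\}$. The topologies on objects and on arrows are generated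 by the sets $\{\mu\mid\alpha\in\mu\}$ for $\alpha\in\mathsf D[A]$ and by the sets $\{P\mid a\in P\}$ for $a\in A$, respectively. For a homomorphism $h:A\to B$, $\mathrm{PF}(h):\mathrm{PF}(B)\to\mathrm{PF}(A)$ sends an object $\mu$ to $\{\alpha\in\mathsf D[A]\mid h(\alpha)\in\mu\}$ and relates an arrow $P$ to exactly the prime filters $Q$ of $A$ with $Q\subseteq h^{-1}(P)$. * $\mathrm{SecCl}:\mathscr C\to\mathscr A^{\mathrm{op}}$. The elements of $\mathrm{SecCl}(C)$ are the images $S$ of continuous maps $s:U\to M$ with $U\subseteq O$ clopen and $\mathbf d\circ s=\mathrm{id}_U$, with operations $S\,;T=\{a\cdot b\mid a\in S,\ b\in T,\ \mathbf r(a)=\mathbf d(b)\}$, $\mathsf A(S)=\{1_x\mid x\in O\setminus\mathbf d[S]\}$, $\mathsf R(S)=\{1_x\mid x\in\mathbf r[S]\}$, $S\sqcup T=S\cup(\mathsf A(S)\,;T)$. For a morphism $F:C\to D$, $\mathrm{SecCl}(F):\mathrm{SecCl}(D)\to\mathrm{SecCl}(C)$ is $S\mapsto F^{-1}(S)$. 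-/

import Mathlib

open CategoryTheory Opposite

universe u

namespace PartialFunctionDuality

/-! ## Algebras of partial functions -/

/-- Algebras of the signature with composition (first composee on the left), antidomain,
range and preferential union. -/
class FunSig (A : Type u) where
  comp : A → A → A
  antidom : A → A
  rng : A → A
  pref : A → A → A

/-- A partial function on `X`: a functional subset of `X × X`. -/
@[ext]
structure PartialFn (X : Type u) where
  graph : Set (X × X)
  functional : ∀ x y z, (x, y) ∈ graph → (x, z) ∈ graph → y = z

/-- The algebra of all partial functions on `X` with the set-theoretic operations. -/
instance PartialFn.instFunSig (X : Type u) : FunSig (PartialFn X) where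
  comp f g :=
    { graph := {p | ∃ y, (p.1, y) ∈ f.graph ∧ (y, p.2) ∈ g.graph}
      functional := by
        rintro x y z ⟨a, ha, hy⟩ ⟨b, hb, hz⟩
        have hab := f.functional _ _ _ ha hb
        subst hab
        exact g.functional _ _ _ hy hz }
  antidom f :=
    { graph := {p | p.1 = p.2 ∧ ¬ ∃ y, (p.1, y) ∈ f.graph}
      functional := by
        rintro x y z ⟨h, _⟩ ⟨h', _⟩
        exact h.symm.trans h' }
  rng f :=
    { graph := {p | p.1 = p.2 ∧ ∃ x, (x, p.1) ∈ f.graph}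
      functional := by
        rintro x y z ⟨h, _⟩ ⟨h', _⟩
        exact h.symm.trans h' }
  pref f g :=
    { graph := {p | p ∈ f.graph ∨ ((¬ ∃ y, (p.1, y) ∈ f.graph) ∧ p ∈ g.graph)}
      functional := by
        rintro x y z (h | ⟨h, hg⟩) (h' | ⟨h', hg'⟩)
        · exact f.functional _ _ _ h h'
        · exact absurd ⟨_, h⟩ h'
        · exact absurd ⟨_, h'⟩ h
        · exact g.functional _ _ _ hg hg' }

/-- Homomorphisms of algebras. -/
@[ext]
structure FunHom (A B : Type u) [FunSig A] [FunSig B] where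
  toFun : A → B
  map_comp : ∀ a b, toFun (FunSig.comp a b) = FunSig.comp (toFun a) (toFun b)
  map_antidom : ∀ a, toFun (FunSig.antidom a) = FunSig.antidom (toFun a)
  map_rng : ∀ a, toFun (FunSig.rng a) = FunSig.rng (toFun a)
  map_pref : ∀ a b, toFun (FunSig.pref a b) = FunSig.pref (toFun a) (toFun b)

/-- `A` is representable by partial functions: it is isomorphic to an algebra of partial
functions on some set, that is, it embeds in the algebra of all partial functions on a set. -/
def Representable (A : Type u) [FunSig A] : Prop :=
  ∃ (X : Type u) (φ : FunHom A (PartialFn X)), Function.Injective φ.toFun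

/-- The objects of the first category: (nonempty) algebras representable by partial functions. -/
structure RepAlg : Type (u + 1) where
  carrier : Type u
  [sig : FunSig carrier]
  [nonempty : Nonempty carrier]
  representable : Representable carrier

instance : CoeSort RepAlg.{u} (Type u) := ⟨RepAlg.carrier⟩

attribute [instance] RepAlg.sig RepAlg.nonempty

/-- The first category: all homomorphisms between representable algebras. -/
instance : Category RepAlg.{u} where
  Hom A B := FunHom A B
  id A := ⟨id, fun _ _ => rfl, fun _ => rfl, fun _ => rfl, fun _ _ => rfl⟩
  comp f g := ⟨g.toFun ∘ f.toFun, by simp [f.map_comp, g.map_comp],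
    by simp [f.map_antidom, g.map_antidom], by simp [f.map_rng, g.map_rng],
    by simp [f.map_pref, g.map_pref]⟩

/-! ## Filters -/

section Filters

variable {A : Type u} [FunSig A]

/-- The domain operation. -/
def dom (a : A) : A := FunSig.antidom (FunSig.antidom a)

/-- The order `a ≤ b`, represented by inclusion of partial functions. -/
def le (a b : A) : Prop := FunSig.comp (dom a) b = a

variable (A) in
/-- The set `D[A]` of domain elements, i.e. elements of the form `antidom b`. -/
def domElts : Set A := Set.range FunSig.antidom

/-- The upward closure of `T` within `S`. -/
def upClosure (S T : Set A) : Set A := {b | b ∈ S ∧ ∃ a ∈ T, le a b}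

/-- `F` is a filter of the ordered set `S`: a nonempty, upward closed and downward directed
subset of `S`. -/
structure IsFilterOn (S F : Set A) : Prop where
  subset : F ⊆ S
  nonempty : F.Nonempty
  up : ∀ a ∈ F, ∀ b ∈ S, le a b → b ∈ F
  down : ∀ a ∈ F, ∀ b ∈ F, ∃ c ∈ F, le c a ∧ le c b

/-- Prime filters of the algebra `A`. -/
structure IsPrimeFilter (P : Set A) : Prop where
  filter : IsFilterOn Set.univ P
  proper : P ≠ Set.univ
  prime : ∀ a b, FunSig.pref a b ∈ P → a ∈ P ∨ b ∈ P

/-- Ultrafilters of `D[A]`: maximal proper filters. -/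
def IsDomUltrafilter (μ : Set A) : Prop :=
  Maximal (fun ν => IsFilterOn (domElts A) ν ∧ ν ≠ domElts A) μ

end Filters

/-! ## Stone étale categories -/

/-- A topological category: a small category internal to topological spaces. Composition is
written with the first composee on the left. -/
structure TopologicalCategory : Type (u + 1) where
  Obj : Type u
  Arr : Type u
  [topObj : TopologicalSpace Obj]
  [topArr : TopologicalSpace Arr]
  src : Arr → Obj
  tgt : Arr → Obj
  one : Obj → Arr
  comp : ∀ f g : Arr, tgt f = src g → Arr
  src_one : ∀ x, src (one x) = x
  tgt_one : ∀ x, tgt (one x) = x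
  src_comp : ∀ f g h, src (comp f g h) = src f
  tgt_comp : ∀ f g h, tgt (comp f g h) = tgt g
  one_comp : ∀ f, comp (one (src f)) f (tgt_one _) = f
  comp_one : ∀ f, comp f (one (tgt f)) (src_one _).symm = f
  assoc : ∀ (f g k : Arr) (h : tgt f = src g) (h' : tgt g = src k),
    comp (comp f g h) k ((tgt_comp f g h).trans h') =
      comp f (comp g k h') (h.trans (src_comp g k h').symm)
  continuous_src : Continuous src
  continuous_tgt : Continuous tgt
  continuous_one : Continuous one
  continuous_comp :
    Continuous (fun p : {p : Arr × Arr // tgt p.1 = src p.2} => comp p.1.1 p.1.2 p.2)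

attribute [instance] TopologicalCategory.topObj TopologicalCategory.topArr

/-- An arrow is an epimorphism. (Arrows `g`, `g'` with `f · g = f · g'` are automatically
parallel.) -/
def TopologicalCategory.IsEpi (C : TopologicalCategory.{u}) (f : C.Arr) : Prop :=
  ∀ (g g' : C.Arr) (h : C.tgt f = C.src g) (h' : C.tgt f = C.src g'),
    C.comp f g h = C.comp f g' h' → g = g'

/-- The objects of the second category: Stone étale categories all of whose arrows are
epimorphisms. -/
structure StoneEtaleCat : Type (u + 1) extends TopologicalCategory.{u} where
  compact : CompactSpace Obj
  totallySeparated : TotallySeparatedSpace Obj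
  localHomeo_src : IsLocalHomeomorph src
  openMap_tgt : IsOpenMap tgt
  epi : ∀ f, toTopologicalCategory.IsEpi f

/-- Multivalued functors between topological categories: a continuous function on objects
and a continuous relation on arrows. -/
@[ext]
structure MultiFunctor (C D : TopologicalCategory.{u}) where
  obj : C.Obj → D.Obj
  rel : C.Arr → D.Arr → Prop
  rel_src : ∀ f g, rel f g → D.src g = obj (C.src f)
  rel_tgt : ∀ f g, rel f g → D.tgt g = obj (C.tgt f)
  rel_one : ∀ x, rel (C.one x) (D.one (obj x))
  rel_comp : ∀ f₁ f₂ g₁ g₂ (h : C.tgt f₁ = C.src f₂) (h' : D.tgt g₁ = D.src g₂),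
    rel f₁ g₁ → rel f₂ g₂ → rel (C.comp f₁ f₂ h) (D.comp g₁ g₂ h')
  continuous_obj : Continuous obj
  continuous_rel : ∀ U : Set D.Arr, IsOpen U → IsOpen {f | ∃ g ∈ U, rel f g}

namespace MultiFunctor

variable {C D E : TopologicalCategory.{u}}

/-- Star coherence: star injectivity, star surjectivity and co-pseudo star surjectivity. -/
structure IsStarCoherent (F : MultiFunctor C D) : Prop where
  starInjective : ∀ f₁ f₂ g, C.src f₁ = C.src f₂ → F.rel f₁ g → F.rel f₂ g → f₁ = f₂
  starSurjective : ∀ x g, D.src g = F.obj x → ∃ f, C.src f = x ∧ F.rel f g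
  coPseudoStarSurjective : ∀ (y : C.Obj) (U : Set D.Arr), IsOpen U →
    (∃ g ∈ U, D.tgt g = F.obj y) → ∃ f, C.tgt f = y ∧ ∃ g ∈ U, F.rel f g

/-- The identity multivalued functor. -/
def idFunctor (C : TopologicalCategory.{u}) : MultiFunctor C C where
  obj := id
  rel f g := f = g
  rel_src := by rintro f _ rfl; rfl
  rel_tgt := by rintro f _ rfl; rfl
  rel_one _ := rfl
  rel_comp := by rintro f₁ f₂ _ _ h h' rfl rfl; rfl
  continuous_obj := continuous_id
  continuous_rel U hU := by simpa using hU

/-- Composition of multivalued functors (relational composition on arrows). -/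
def compFunctor (F : MultiFunctor C D) (G : MultiFunctor D E) : MultiFunctor C E where
  obj := G.obj ∘ F.obj
  rel f k := ∃ g, F.rel f g ∧ G.rel g k
  rel_src := by
    rintro f k ⟨g, h, h'⟩
    simp [G.rel_src _ _ h', F.rel_src _ _ h]
  rel_tgt := by
    rintro f k ⟨g, h, h'⟩
    simp [G.rel_tgt _ _ h', F.rel_tgt _ _ h]
  rel_one x := ⟨_, F.rel_one x, G.rel_one _⟩
  rel_comp := by
    rintro f₁ f₂ k₁ k₂ h h' ⟨g₁, a₁, b₁⟩ ⟨g₂, a₂, b₂⟩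
    have hg : D.tgt g₁ = D.src g₂ := by
      rw [F.rel_tgt _ _ a₁, F.rel_src _ _ a₂, h]
    exact ⟨D.comp g₁ g₂ hg, F.rel_comp _ _ _ _ h hg a₁ a₂, G.rel_comp _ _ _ _ hg h' b₁ b₂⟩
  continuous_obj := G.continuous_obj.comp F.continuous_obj
  continuous_rel U hU := by
    have h := F.continuous_rel _ (G.continuous_rel U hU)
    convert h using 1
    ext f
    constructor
    · rintro ⟨k, hk, g, h₁, h₂⟩
      exact ⟨g, ⟨k, hk, h₂⟩, h₁⟩
    · rintro ⟨g, ⟨k, hk, h₂⟩, h₁⟩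
      exact ⟨k, hk, g, h₁, h₂⟩

theorem idFunctor_isStarCoherent (C : TopologicalCategory.{u}) :
    (idFunctor C).IsStarCoherent where
  starInjective := by rintro f₁ f₂ g _ rfl rfl; rfl
  starSurjective x g h := ⟨g, h, rfl⟩
  coPseudoStarSurjective := by
    rintro y U _ ⟨g, hg, h⟩
    exact ⟨g, h, g, hg, rfl⟩

theorem IsStarCoherent.compFunctor {F : MultiFunctor C D} {G : MultiFunctor D E}
    (hF : F.IsStarCoherent) (hG : G.IsStarCoherent) : (F.compFunctor G).IsStarCoherent where
  starInjective := by
    rintro f₁ f₂ k hs ⟨g₁, a₁, b₁⟩ ⟨g₂, a₂, b₂⟩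
    have hg : g₁ = g₂ := hG.starInjective _ _ k
      (by rw [F.rel_src _ _ a₁, F.rel_src _ _ a₂, hs]) b₁ b₂
    subst hg
    exact hF.starInjective _ _ _ hs a₁ a₂
  starSurjective x k hk := by
    obtain ⟨g, hg, hgk⟩ := hG.starSurjective (F.obj x) k hk
    obtain ⟨f, hf, hfg⟩ := hF.starSurjective x g hg
    exact ⟨f, hf, g, hfg, hgk⟩
  coPseudoStarSurjective := by
    intro y U hU hne
    obtain ⟨g, hg, k, hk, hgk⟩ := hG.coPseudoStarSurjective (F.obj y) U hU hne
    obtain ⟨f, hf, g', ⟨k', hk', hgk'⟩, hfg'⟩ := hF.coPseudoStarSurjective y _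
      (G.continuous_rel U hU) ⟨g, ⟨k, hk, hgk⟩, hg⟩
    exact ⟨f, hf, k', hk', g', hfg', hgk'⟩

end MultiFunctor

/-- Morphisms of the second category: star-coherent multivalued functors of topological
categories. -/
@[ext]
structure StarCoherentFunctor (C D : TopologicalCategory.{u}) extends MultiFunctor C D where
  coherent : toMultiFunctor.IsStarCoherent

/-- The second category. -/
instance : Category StoneEtaleCat.{u} where
  Hom C D := StarCoherentFunctor C.toTopologicalCategory D.toTopologicalCategory
  id C := ⟨MultiFunctor.idFunctor _, MultiFunctor.idFunctor_isStarCoherent _⟩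
  comp F G := ⟨F.toMultiFunctor.compFunctor G.toMultiFunctor, F.coherent.compFunctor G.coherent⟩
  id_comp F := by
    apply StarCoherentFunctor.ext
    · rfl
    · funext f g
      simp [MultiFunctor.compFunctor, MultiFunctor.idFunctor]
  comp_id F := by
    apply StarCoherentFunctor.ext
    · rfl
    · funext f g
      simp [MultiFunctor.compFunctor, MultiFunctor.idFunctor]
  assoc F G H := by
    apply StarCoherentFunctor.ext
    · rfl
    · funext f g
      apply propext
      constructor
      · rintro ⟨b, ⟨a, h₁, h₂⟩, h₃⟩
        exact ⟨a, h₁, b, h₂, h₃⟩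
      · rintro ⟨a, h₁, b, h₂, h₃⟩
        exact ⟨b, ⟨a, h₁, h₂⟩, h₃⟩

/-! ## The prime filter functor -/

/-- The topological category `C`, with objects and arrows named by `o` and `m`, is the category
of prime filters of `A`: objects are the ultrafilters of `D[A]`, arrows are the prime filters
of `A`, the source of `P` is `D[P]`, its target is the upward closure of `R[P]` in `D[A]`, the
identity of `μ` is the upward closure of `μ`, the composite of `P` and `Q` is the upward closure
of `P ; Q`, and the topologies are generated by the sets `{μ | α ∈ μ}` with `α ∈ D[A]` and
`{P | a ∈ P}` with `a ∈ A`. -/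
structure IsPrimeFilterCategory (A : Type u) [FunSig A] (C : TopologicalCategory.{u})
    (o : C.Obj ≃ {μ : Set A // IsDomUltrafilter μ})
    (m : C.Arr ≃ {P : Set A // IsPrimeFilter P}) : Prop where
  src_eq : ∀ f, (o (C.src f)).1 = dom '' (m f).1
  tgt_eq : ∀ f, (o (C.tgt f)).1 = upClosure (domElts A) (FunSig.rng '' (m f).1)
  one_eq : ∀ x, (m (C.one x)).1 = upClosure Set.univ (o x).1
  comp_eq : ∀ f g h,
    (m (C.comp f g h)).1 = upClosure Set.univ (Set.image2 FunSig.comp (m f).1 (m g).1)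
  topObj_eq : C.topObj =
    TopologicalSpace.generateFrom {U | ∃ α ∈ domElts A, U = {x | α ∈ (o x).1}}
  topArr_eq : C.topArr =
    TopologicalSpace.generateFrom {U | ∃ a : A, U = {f | a ∈ (m f).1}}

/-- The functor `F` sends an algebra to its category of prime filters, and a homomorphism
`h : A → B` to the multivalued functor given by inverse image: an ultrafilter `μ` of `D[B]` goes
to `{α ∈ D[A] | h α ∈ μ}`, and a prime filter `P` of `B` is related to the prime filters `Q`
of `A` included in the inverse image of `P`. -/
def IsPrimeFilterFunctor (F : RepAlg.{u}ᵒᵖ ⥤ StoneEtaleCat.{u}) : Prop :=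
  ∃ (o : ∀ A : RepAlg.{u}, (F.obj (op A)).Obj ≃ {μ : Set A // IsDomUltrafilter μ})
    (m : ∀ A : RepAlg.{u}, (F.obj (op A)).Arr ≃ {P : Set A // IsPrimeFilter P}),
    (∀ A : RepAlg.{u},
      IsPrimeFilterCategory A (F.obj (op A)).toTopologicalCategory (o A) (m A)) ∧
    ∀ (A B : RepAlg.{u}) (h : A ⟶ B),
      (∀ x, (o A ((F.map h.op).obj x)).1 = {α | α ∈ domElts A ∧ h.toFun α ∈ (o B x).1}) ∧
      (∀ f g, (F.map h.op).rel f g ↔ (m A g).1 ⊆ h.toFun ⁻¹' (m B f).1)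

/-! ## The functor of sections over clopens -/

namespace TopologicalCategory

variable (C : TopologicalCategory.{u})

/-- `S` is (the image of) a continuous section of the source map over a clopen set. -/
def IsClopenSection (S : Set C.Arr) : Prop :=
  ∃ (U : Set C.Obj) (f : U → C.Arr), IsClopen U ∧ Continuous f ∧
    (∀ x, C.src (f x) = x) ∧ S = Set.range f

/-- Composition of sets of arrows. -/
def setComp (S T : Set C.Arr) : Set C.Arr :=
  {k | ∃ f ∈ S, ∃ g ∈ T, ∃ h : C.tgt f = C.src g, k = C.comp f g h}

/-- Antidomain of a set of arrows. -/
def setAntidom (S : Set C.Arr) : Set C.Arr := C.one '' (C.src '' S)ᶜ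

/-- Range of a set of arrows. -/
def setRng (S : Set C.Arr) : Set C.Arr := C.one '' (C.tgt '' S)

/-- Preferential union of sets of arrows. -/
def setPref (S T : Set C.Arr) : Set C.Arr := S ∪ C.setComp (C.setAntidom S) T

end TopologicalCategory

/-- The algebra `A`, with elements named by `s`, is the algebra of sections of the source map
of `C` over clopen sets of objects. -/
structure IsSectionAlgebra (C : TopologicalCategory.{u}) (A : Type u) [FunSig A]
    (s : A ≃ {S : Set C.Arr // C.IsClopenSection S}) : Prop where
  comp_eq : ∀ a b, (s (FunSig.comp a b)).1 = C.setComp (s a).1 (s b).1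
  antidom_eq : ∀ a, (s (FunSig.antidom a)).1 = C.setAntidom (s a).1
  rng_eq : ∀ a, (s (FunSig.rng a)).1 = C.setRng (s a).1
  pref_eq : ∀ a b, (s (FunSig.pref a b)).1 = C.setPref (s a).1 (s b).1

/-- The functor `G` sends a category to its algebra of sections over clopens, and a multivalued
functor `F : C → D` to the homomorphism `S ↦ F⁻¹(S)` from the algebra of `D` to that of `C`. -/
def IsSectionFunctor (G : StoneEtaleCat.{u} ⥤ RepAlg.{u}ᵒᵖ) : Prop :=
  ∃ s : ∀ C : StoneEtaleCat.{u}, (G.obj C).unop ≃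
      {S : Set C.Arr // C.toTopologicalCategory.IsClopenSection S},
    (∀ C : StoneEtaleCat.{u},
      IsSectionAlgebra C.toTopologicalCategory (G.obj C).unop (s C)) ∧
    ∀ (C D : StoneEtaleCat.{u}) (F : C ⟶ D) (a : (G.obj D).unop),
      (s C ((G.map F).unop.toFun a)).1 = {f | ∃ g ∈ (s D a).1, F.rel f g}

end PartialFunctionDuality

/-! The duality is of Stone type, with prime filters in the role of germs. Since partial functions
are single-valued, a prime filter of `A` is determined by its source, an ultrafilter of the Boolean
algebra `D[A]`, and any one member `a`: it consists of the elements above a restriction of `a` to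
some member of the source (`IsPrimeFilter.eq_germ`). Conversely, all such germs are prime
(`IsDomUltrafilter.isPrimeFilter_germ`). Hence each set `{P | a ∈ P}` is a section of the source map
over a clopen set, and the source map is a local homeomorphism. The target map is open because every
ultrafilter containing `rng a` is the target of a germ of `a` (`IsDomUltrafilter.exists_target_eq`).
Arrows are epimorphisms because a function can be cancelled on its range (`rng_comp_eq`).

In the other direction, a clopen section of `C` acts as a partial function on sets of arrows with
common source, each arrow acting by left division. That arrows are epimorphisms makes this action
surjective onto the sets of arrows at the target, which is what the range operation requires
(`Costar.exists_act_eq`).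

The map `a ↦ {P | a ∈ P}` is injective because principal ultrafilters at the points of a
representation separate elements. It is surjective because compactness covers a section by finitely
many basic sets, which preferential union glues together (`exists_basicSet_eq`). An object or arrow
of `C` is recovered from the clopen sections containing its identity or itself, by compactness and
total separatedness (`objPoint_surjective`, `arrPoint_surjective`).

On morphisms, the two star conditions at sources make inverse images of sections compatible with
composition, antidomain and preferential union, and the condition at targets makes them compatible
with range. The latter is stated with open sets because membership of `rng a` in an ultrafilter
controls the germs with that target through one element `a` at a time. -/

namespace PartialFunctionDuality

open FunSig

local infixl:70 " ⬝ " => FunSig.comp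

/-! ## Calculating in a representable algebra -/

namespace RepAlg

variable {A B : RepAlg.{u}}

/-- The points of a fixed representation of `A`. -/
noncomputable def Pts (A : RepAlg.{u}) : Type u := A.representable.choose

/-- The partial function representing `a` sends `x` to `y`. -/
def Maps (a : A) (x y : A.Pts) : Prop :=
  (x, y) ∈ (A.representable.choose_spec.choose.toFun a).graph

theorem Maps.eq {a : A} {x y z : A.Pts} (h : Maps a x y) (h' : Maps a x z) : y = z :=
  PartialFn.functional _ _ _ _ h h'

/-- Injectivity of the representation turns every identity of `A` into a first-order statement about
points, which the `maps_*` lemmas unfold. The calculations of this section all rest on this. -/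
theorem ext_maps {a b : A} (h : ∀ x y, Maps a x y ↔ Maps b x y) : a = b := by
  apply A.representable.choose_spec.choose_spec
  apply PartialFn.ext
  ext ⟨x, y⟩
  exact h x y

@[simp] theorem maps_comp {a b : A} {x z : A.Pts} :
    Maps (a ⬝ b) x z ↔ ∃ y, Maps a x y ∧ Maps b y z := by
  unfold Maps
  rw [FunHom.map_comp]
  rfl

@[simp] theorem maps_antidom {a : A} {x y : A.Pts} :
    Maps (antidom a) x y ↔ x = y ∧ ∀ z, ¬ Maps a x z := by
  unfold Maps
  rw [FunHom.map_antidom, ← not_exists]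
  rfl

@[simp] theorem maps_rng {a : A} {x y : A.Pts} :
    Maps (rng a) x y ↔ x = y ∧ ∃ z, Maps a z x := by
  unfold Maps
  rw [FunHom.map_rng]
  rfl

@[simp] theorem maps_pref {a b : A} {x y : A.Pts} :
    Maps (pref a b) x y ↔ Maps a x y ∨ (∀ z, ¬ Maps a x z) ∧ Maps b x y := by
  unfold Maps
  rw [FunHom.map_pref, ← not_exists]
  rfl

@[simp] theorem maps_dom {a : A} {x y : A.Pts} :
    Maps (dom a) x y ↔ x = y ∧ ∃ z, Maps a x z := by
  simp only [dom, maps_antidom]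
  grind

/-- Domain elements are the subidentities; a subidentity is the antidomain of its own antidomain. -/
theorem mem_domElts_iff {α : A} : α ∈ domElts A ↔ ∀ x y, Maps α x y → x = y := by
  constructor
  · rintro ⟨b, rfl⟩
    simp +contextual
  · intro h
    refine ⟨antidom α, ext_maps fun x y => ?_⟩
    simp only [maps_antidom]
    grind

theorem le_iff {a b : A} : le a b ↔ ∀ x y, Maps a x y → Maps b x y := by
  constructor
  · intro h x y hxy
    rw [← show dom a ⬝ b = a from h] at hxy
    simp only [maps_comp, maps_dom] at hxy
    grind
  · intro h
    refine ext_maps fun x y => ?_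
    simp only [maps_comp, maps_dom]
    constructor
    · rintro ⟨_, ⟨rfl, z, hz⟩, hy⟩
      rwa [(h _ _ hz).eq hy] at hz
    · intro hxy
      exact ⟨x, ⟨rfl, y, hxy⟩, h _ _ hxy⟩

theorem le.refl (a : A) : le a a := le_iff.2 fun _ _ => id

theorem le.trans {a b c : A} (h : le a b) (h' : le b c) : le a c := by
  simp only [le_iff] at *
  exact fun x y hxy => h' _ _ (h _ _ hxy)

theorem le.antisymm {a b : A} (h : le a b) (h' : le b a) : a = b :=
  ext_maps fun x y => ⟨le_iff.1 h x y, le_iff.1 h' x y⟩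

variable (A) in
/-- The empty function. -/
noncomputable def zero : A := antidom (Classical.arbitrary A) ⬝ Classical.arbitrary A

@[simp] theorem maps_zero {x y : A.Pts} : ¬ Maps (zero A) x y := by
  simp only [zero, maps_comp, maps_antidom]
  grind

theorem zero_le (a : A) : le (zero A) a := le_iff.2 (by simp)

theorem eq_zero {a : A} (h : ∀ x y, ¬ Maps a x y) : a = zero A :=
  ext_maps fun x y => by simp [h]

theorem zero_mem_domElts : zero A ∈ domElts A := mem_domElts_iff.2 (by simp)

theorem antidom_mem (a : A) : antidom a ∈ domElts A := ⟨a, rfl⟩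

theorem dom_mem (a : A) : dom a ∈ domElts A := ⟨_, rfl⟩

theorem rng_mem (a : A) : rng a ∈ domElts A := mem_domElts_iff.2 (by simp +contextual)

theorem comp_mem_domElts {α β : A} (hα : α ∈ domElts A) (hβ : β ∈ domElts A) :
    α ⬝ β ∈ domElts A := by
  simp only [mem_domElts_iff, maps_comp] at *
  grind

theorem dom_eq {α : A} (h : α ∈ domElts A) : dom α = α := by
  rw [mem_domElts_iff] at h
  refine ext_maps fun x y => ?_
  simp only [maps_dom]
  grind

theorem comp_assoc (a b c : A) : a ⬝ b ⬝ c = a ⬝ (b ⬝ c) := by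
  refine ext_maps fun x y => ?_
  simp only [maps_comp]
  grind

theorem dom_comp_self (a : A) : dom a ⬝ a = a := le.refl a

theorem comp_rng_self (a : A) : a ⬝ rng a = a := by
  refine ext_maps fun x y => ?_
  simp only [maps_comp, maps_rng]
  grind

theorem comp_le_of_mem {α : A} (h : α ∈ domElts A) (a : A) : le (α ⬝ a) a := by
  simp only [le_iff, mem_domElts_iff, maps_comp] at *
  grind

theorem comp_le_left {α β : A} (h : β ∈ domElts A) : le (α ⬝ β) α := by
  simp only [le_iff, mem_domElts_iff, maps_comp] at *
  grind

theorem comp_le_comp {a b c d : A} (h : le a b) (h' : le c d) : le (a ⬝ c) (b ⬝ d) := by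
  simp only [le_iff, maps_comp] at *
  grind

theorem le_comp {α β γ : A} (hγ : γ ∈ domElts A) (h : le γ α) (h' : le γ β) :
    le γ (α ⬝ β) := by
  simp only [le_iff, mem_domElts_iff, maps_comp] at *
  grind

theorem dom_mono {a b : A} (h : le a b) : le (dom a) (dom b) := by
  simp only [le_iff, maps_dom] at *
  grind

theorem rng_mono {a b : A} (h : le a b) : le (rng a) (rng b) := by
  simp only [le_iff, maps_rng] at *
  grind

theorem rng_comp_le (a b : A) : le (rng (a ⬝ b)) (rng b) := by
  simp only [le_iff, maps_rng, maps_comp] at *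
  grind

theorem rng_comp_le_of_mem {a β : A} (h : β ∈ domElts A) : le (rng (a ⬝ β)) β := by
  simp only [le_iff, maps_rng, maps_comp, mem_domElts_iff] at *
  grind

theorem dom_comp_dom {α a : A} (h : α ∈ domElts A) : dom (α ⬝ a) = α ⬝ dom a := by
  rw [mem_domElts_iff] at h
  refine ext_maps fun x y => ?_
  simp only [maps_dom, maps_comp]
  grind

theorem dom_comp_le (a b : A) : le (dom (a ⬝ b)) (dom a) := by
  simp only [le_iff, maps_dom, maps_comp] at *
  grind

theorem antidom_dom (a : A) : antidom (dom a) = antidom a := by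
  refine ext_maps fun x y => ?_
  simp only [maps_antidom, maps_dom]
  grind

theorem comp_antidom_self {α : A} (h : α ∈ domElts A) : α ⬝ antidom α = zero A := by
  refine eq_zero fun x y => ?_
  simp only [maps_comp, maps_antidom, mem_domElts_iff] at *
  grind

theorem le_antidom {α β : A} (hα : α ∈ domElts A)
    (h : α ⬝ β = zero A) : le α (antidom β) := by
  have h0 : ∀ x y, ¬ Maps (α ⬝ β) x y := by simp [h]
  simp only [maps_comp, le_iff, maps_antidom, mem_domElts_iff] at *
  grind

theorem dom_pref_comp (a b : A) : dom a ⬝ pref a b = a := by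
  refine ext_maps fun x y => ?_
  simp only [maps_comp, maps_dom, maps_pref]
  constructor
  · rintro ⟨_, ⟨rfl, z, hz⟩, h⟩
    grind
  · intro h
    exact ⟨x, ⟨rfl, y, h⟩, Or.inl h⟩

theorem antidom_comp_pref_le (a b : A) : le (antidom a ⬝ pref a b) b := by
  simp only [le_iff, maps_comp, maps_antidom, maps_pref]
  grind

theorem le_pref_left (a b : A) : le a (pref a b) := by
  simp only [le_iff, maps_pref]
  grind

theorem antidom_comp_le_pref (a b : A) : le (antidom a ⬝ b) (pref a b) := by
  simp only [le_iff, maps_pref, maps_comp, maps_antidom]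
  grind

/-- `a` is the preferential union of its restrictions to `α` and to the complement of `α`. -/
theorem pref_split {α : A} (h : α ∈ domElts A) (a : A) :
    pref (α ⬝ a) (antidom α ⬝ a) = a := by
  rw [mem_domElts_iff] at h
  refine ext_maps fun x y => ?_
  simp only [maps_pref, maps_comp, maps_antidom]
  constructor
  · grind
  · intro hxy
    by_cases hx : ∃ z, Maps α x z
    · obtain ⟨z, hz⟩ := hx
      have := h _ _ hz
      grind
    · push Not at hx
      refine Or.inr ⟨?_, x, ⟨rfl, hx⟩, hxy⟩
      grind

/-- The splitting is by values instead of arguments. Combined with primeness, it lets the target of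
a prime filter decide every `β`. -/
theorem pref_split_right {β : A} (h : β ∈ domElts A) (a : A) :
    pref (a ⬝ β) (a ⬝ antidom β) = a := by
  rw [mem_domElts_iff] at h
  refine ext_maps fun x y => ?_
  simp only [maps_pref, maps_comp, maps_antidom]
  constructor
  · grind
  · intro hxy
    by_cases hx : ∃ z, Maps β y z
    · obtain ⟨z, hz⟩ := hx
      have := h _ _ hz
      grind
    · push Not at hx
      refine Or.inr ⟨fun z ⟨w, hw, hwz⟩ => ?_, y, hxy, rfl, hx⟩
      rw [← hxy.eq hw] at hwz
      exact hx _ hwz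

theorem dom_eq_zero {a : A} (h : dom a = zero A) : a = zero A := by
  have h0 : ∀ x y, ¬ Maps (dom a) x y := by simp [h]
  simp only [maps_dom] at h0
  exact eq_zero (by grind)

theorem rng_eq_zero {a : A} (h : rng a = zero A) : a = zero A := by
  have h0 : ∀ x y, ¬ Maps (rng a) x y := by simp [h]
  simp only [maps_rng] at h0
  exact eq_zero (by grind)

/-- Used contrapositively: where the range of `a` meets the domain of `b`, the composite is
nonempty. This shows that composites of prime filters are proper and that preimages of an
ultrafilter form a proper filter base. -/
theorem rng_comp_dom_eq_zero {a b : A} (h : a ⬝ b = zero A) : rng a ⬝ dom b = zero A := by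
  have h0 : ∀ x y, ¬ Maps (a ⬝ b) x y := by simp [h]
  simp only [maps_comp] at h0
  refine eq_zero fun x y => ?_
  simp only [maps_comp, maps_dom, maps_rng]
  grind

/-- A function cancels on the left, on its range. -/
theorem rng_comp_eq {a b c : A} (h : a ⬝ b = a ⬝ c) : rng a ⬝ b = rng a ⬝ c := by
  have h0 : ∀ x y, Maps (a ⬝ b) x y ↔ Maps (a ⬝ c) x y := by simp [h]
  refine ext_maps fun x y => ?_
  simp only [maps_comp, maps_rng] at *
  constructor
  · rintro ⟨_, ⟨rfl, z, hz⟩, h1⟩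
    obtain ⟨w, hw, hw'⟩ := (h0 z y).1 ⟨x, hz, h1⟩
    rw [← hz.eq hw] at hw'
    exact ⟨x, ⟨rfl, z, hz⟩, hw'⟩
  · rintro ⟨_, ⟨rfl, z, hz⟩, h1⟩
    obtain ⟨w, hw, hw'⟩ := (h0 z y).2 ⟨x, hz, h1⟩
    rw [← hz.eq hw] at hw'
    exact ⟨x, ⟨rfl, z, hz⟩, hw'⟩

/-- Restricting `a` to the preimage of `β`. -/
theorem dom_comp_comp_le (a : A) {β : A} (h : β ∈ domElts A) : le (dom (a ⬝ β) ⬝ a) (a ⬝ β) := by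
  rw [mem_domElts_iff] at h
  simp only [le_iff, maps_comp, maps_dom]
  rintro x y ⟨_, ⟨rfl, w, v, hv, hvw⟩, hxy⟩
  rw [hxy.eq hv]
  exact ⟨v, hv, by rwa [← h _ _ hvw] at hvw⟩

theorem rng_dom_comp_comp_le (a b : A) : le (rng (dom (a ⬝ b) ⬝ a)) (dom b) := by
  simp only [le_iff, maps_comp, maps_dom, maps_rng]
  rintro x y ⟨rfl, z, _, ⟨rfl, w, v, hv, hvw⟩, hzx⟩
  rw [hv.eq hzx] at hvw
  exact ⟨rfl, w, hvw⟩

/-- Preimages under a single-valued `a` commute with intersections. -/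
theorem dom_comp_dom_comp (a : A) {β γ : A} (hβ : β ∈ domElts A) :
    dom (a ⬝ β) ⬝ dom (a ⬝ γ) = dom (a ⬝ (β ⬝ γ)) := by
  rw [mem_domElts_iff] at hβ
  refine ext_maps fun x y => ?_
  simp only [maps_comp, maps_dom]
  constructor
  · rintro ⟨_, ⟨rfl, w, v, hv, hvw⟩, rfl, w', v', hv', hvw'⟩
    rw [hv'.eq hv] at hvw'
    exact ⟨rfl, w', v, hv, v, by rwa [← hβ _ _ hvw] at hvw, hvw'⟩
  · grind

/-- Preferential union with `β` enlarges `a` to an element with domain exactly `β`. This is why the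
domains of the members of a prime filter are already upward closed, whereas the target is defined by
an upward closure. -/
theorem dom_pref_of_le {a β : A} (hβ : β ∈ domElts A) (h : le (dom a) β) :
    dom (pref a β) = β := by
  rw [mem_domElts_iff] at hβ
  simp only [le_iff, maps_dom] at h
  refine ext_maps fun x y => ?_
  simp only [maps_dom, maps_pref]
  constructor
  · grind
  · intro hxy
    refine ⟨hβ _ _ hxy, ?_⟩
    by_cases hx : ∃ z, Maps a x z
    · exact hx.imp fun z hz => Or.inl hz
    · push Not at hx
      exact ⟨y, Or.inr ⟨hx, hxy⟩⟩

theorem map_zero (h : A ⟶ B) : h.toFun (zero A) = zero B := by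
  refine eq_zero fun x y => ?_
  simp only [zero, h.map_comp, h.map_antidom, maps_comp, maps_antidom]
  grind

theorem map_dom (h : A ⟶ B) (a : A) : h.toFun (dom a) = dom (h.toFun a) := by
  simp only [dom, h.map_antidom]

theorem map_le (h : A ⟶ B) {a b : A} (hab : le a b) : le (h.toFun a) (h.toFun b) := by
  unfold le at *
  rw [← map_dom, ← h.map_comp, hab]

theorem map_mem_domElts (h : A ⟶ B) {α : A} (hα : α ∈ domElts A) : h.toFun α ∈ domElts B := by
  obtain ⟨b, rfl⟩ := hα
  exact ⟨h.toFun b, (h.map_antidom b).symm⟩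

end RepAlg

/-! ## Ultrafilters of domain elements -/

open RepAlg

variable {A B : RepAlg.{u}}

/-- Maximality: a filter containing `μ` and some `β ∉ μ` also contains `antidom β`, hence the empty
function, hence everything. -/
theorem isDomUltrafilter_of {μ : Set A} (sub : μ ⊆ domElts A) (ne : μ.Nonempty)
    (inter : ∀ α ∈ μ, ∀ β ∈ μ, α ⬝ β ∈ μ)
    (up : ∀ α ∈ μ, ∀ β ∈ domElts A, le α β → β ∈ μ) (zero_notMem : zero A ∉ μ)
    (compl : ∀ α ∈ domElts A, α ∈ μ ∨ antidom α ∈ μ) : IsDomUltrafilter μ := by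
  refine ⟨⟨⟨sub, ne, up, fun α hα β hβ => ⟨α ⬝ β, inter α hα β hβ, comp_le_left (sub hβ),
    comp_le_of_mem (sub hα) β⟩⟩, fun h => zero_notMem (h ▸ zero_mem_domElts)⟩, ?_⟩
  rintro ν ⟨hν, hν'⟩ hμν β hβ
  rcases compl β (hν.subset hβ) with h | h
  · exact h
  · obtain ⟨γ, hγ, h1, h2⟩ := hν.down β hβ _ (hμν h)
    have h0 : γ = zero A := le.antisymm
      (comp_antidom_self (hν.subset hβ) ▸ le_comp (hν.subset hγ) h1 h2) (zero_le _)
    exact absurd (hν.subset.antisymm fun δ hδ => hν.up _ (h0 ▸ hγ) _ hδ (zero_le δ)) hν'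

namespace IsDomUltrafilter

variable {μ ν : Set A}

theorem subset (h : IsDomUltrafilter μ) : μ ⊆ domElts A := h.1.1.subset

theorem nonempty (h : IsDomUltrafilter μ) : μ.Nonempty := h.1.1.nonempty

theorem up (h : IsDomUltrafilter μ) {α β : A} (hα : α ∈ μ) (hβ : β ∈ domElts A)
    (hle : le α β) : β ∈ μ := h.1.1.up α hα β hβ hle

theorem inter (h : IsDomUltrafilter μ) {α β : A} (hα : α ∈ μ) (hβ : β ∈ μ) : α ⬝ β ∈ μ := by
  obtain ⟨γ, hγ, h1, h2⟩ := h.1.1.down α hα β hβ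
  exact h.up hγ (comp_mem_domElts (h.subset hα) (h.subset hβ)) (le_comp (h.subset hγ) h1 h2)

theorem zero_notMem (h : IsDomUltrafilter μ) : zero A ∉ μ := fun h0 =>
  h.1.2 (h.subset.antisymm fun δ hδ => h.up h0 hδ (zero_le δ))

/-- If `antidom α ∉ μ`, no member of `μ` is disjoint from `α`, so `μ` and `α` generate a proper
filter; by maximality it lies in `μ`. -/
theorem compl (h : IsDomUltrafilter μ) {α : A} (hα : α ∈ domElts A) :
    α ∈ μ ∨ antidom α ∈ μ := by
  by_contra! hn
  have key : ∀ γ ∈ μ, γ ⬝ α ≠ zero A := fun γ hγ h0 =>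
    hn.2 (h.up hγ (antidom_mem _) (le_antidom (h.subset hγ) h0))
  refine hn.1 (h.2 (y := {β | β ∈ domElts A ∧ ∃ γ ∈ μ, le (γ ⬝ α) β}) ⟨⟨fun β hβ => hβ.1, ?_,
    ?_, ?_⟩, ?_⟩ ?_ ?_)
  · obtain ⟨γ, hγ⟩ := h.nonempty
    exact ⟨_, comp_mem_domElts (h.subset hγ) hα, γ, hγ, le.refl _⟩
  · rintro β ⟨-, γ, hγ, h1⟩ δ hδ h2
    exact ⟨hδ, γ, hγ, le.trans h1 h2⟩
  · rintro β ⟨hβ, γ, hγ, h1⟩ δ ⟨hδ, ε, hε, h2⟩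
    have hm := h.inter hγ hε
    refine ⟨_, ⟨comp_mem_domElts (h.subset hm) hα, _, hm, le.refl _⟩, le.trans ?_ h1,
      le.trans ?_ h2⟩
    · exact comp_le_comp (comp_le_left (h.subset hε)) (le.refl _)
    · exact comp_le_comp (comp_le_of_mem (h.subset hγ) _) (le.refl _)
  · intro heq
    obtain ⟨-, γ, hγ, h1⟩ := heq ▸ zero_mem_domElts (A := A)
    exact key γ hγ (le.antisymm h1 (zero_le _))
  · exact fun γ hγ => ⟨h.subset hγ, γ, hγ, comp_le_left hα⟩
  · obtain ⟨γ, hγ⟩ := h.nonempty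
    exact ⟨hα, γ, hγ, comp_le_of_mem (h.subset hγ) _⟩

theorem antidom_mem_iff (h : IsDomUltrafilter μ) {α : A} (hα : α ∈ domElts A) :
    antidom α ∈ μ ↔ α ∉ μ := by
  refine ⟨fun h1 h2 => h.zero_notMem ?_, fun h1 => (h.compl hα).resolve_left h1⟩
  rw [← comp_antidom_self hα]
  exact h.inter h2 h1

/-- Identities between sources, targets and preimages are mostly proved below by this: one inclusion
suffices. -/
theorem eq_of_subset (h : IsDomUltrafilter μ) (h' : IsDomUltrafilter ν) (hs : μ ⊆ ν) : μ = ν :=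
  hs.antisymm (h.2 h'.1 hs)

end IsDomUltrafilter

/-- Ultrafilters of `D[A]` are obtained from ultrafilters on the points of the representation.
Principal ones later separate the elements of `A`. -/
theorem isDomUltrafilter_of_ultrafilter (U : Ultrafilter A.Pts) :
    IsDomUltrafilter {α : A | α ∈ domElts A ∧ {x | Maps α x x} ∈ U} := by
  refine isDomUltrafilter_of (fun α h => h.1) ?_ ?_ ?_ ?_ ?_
  · refine ⟨antidom (zero A), antidom_mem _, ?_⟩
    simp only [maps_antidom, maps_zero, not_false_eq_true, implies_true, and_self, Set.ofPred_true]
    exact (U : Filter A.Pts).univ_sets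
  · rintro α ⟨hα, h1⟩ β ⟨hβ, h2⟩
    refine ⟨comp_mem_domElts hα hβ, ?_⟩
    filter_upwards [h1, h2] with x hx hx'
    exact maps_comp.2 ⟨x, hx, hx'⟩
  · rintro α ⟨hα, h1⟩ β hβ h
    refine ⟨hβ, ?_⟩
    filter_upwards [h1] with x hx
    exact le_iff.1 h _ _ hx
  · rintro ⟨-, h⟩
    simp at h
  · intro α hα
    by_cases h : {x | Maps α x x} ∈ U
    · exact Or.inl ⟨hα, h⟩
    · refine Or.inr ⟨antidom_mem _, ?_⟩
      rw [← Ultrafilter.compl_mem_iff_notMem] at h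
      filter_upwards [h] with x hx
      refine maps_antidom.2 ⟨rfl, fun z hz => hx ?_⟩
      have := mem_domElts_iff.1 hα _ _ hz
      subst this
      exact hz

/-- Filter bases of domain elements extend to ultrafilters. -/
theorem exists_isDomUltrafilter {G : Set A} (sub : G ⊆ domElts A) (ne : G.Nonempty)
    (inter : ∀ α ∈ G, ∀ β ∈ G, α ⬝ β ∈ G) (zero_notMem : zero A ∉ G) :
    ∃ μ, IsDomUltrafilter μ ∧ G ⊆ μ := by
  -- The filter on points generated by the subsets that members of `G` fix; it is proper since `G`
  -- omits the empty function.
  let F : Filter A.Pts :=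
    { sets := {s | ∃ α ∈ G, ∀ x, Maps α x x → x ∈ s}
      univ_sets := ne.imp fun α hα => ⟨hα, fun _ _ => trivial⟩
      sets_of_superset := fun ⟨α, hα, h⟩ hs => ⟨α, hα, fun x hx => hs (h x hx)⟩
      inter_sets := by
        rintro s t ⟨α, hα, h⟩ ⟨β, hβ, h'⟩
        refine ⟨_, inter α hα β hβ, fun x hx => ?_⟩
        obtain ⟨y, h1, h2⟩ := maps_comp.1 hx
        have := mem_domElts_iff.1 (sub hα) _ _ h1
        subst this
        exact ⟨h _ h1, h' _ h2⟩ }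
  have hF : F.NeBot := by
    refine ⟨fun hb => ?_⟩
    obtain ⟨α, hα, h⟩ : ∅ ∈ F := hb ▸ Filter.mem_bot
    refine zero_notMem ?_
    rwa [← eq_zero (a := α)]
    intro x y hxy
    have := mem_domElts_iff.1 (sub hα) _ _ hxy
    subst this
    exact h _ hxy
  exact ⟨_, isDomUltrafilter_of_ultrafilter (Ultrafilter.of F), fun α hα =>
    ⟨sub hα, Ultrafilter.of_le F ⟨α, hα, fun _ => id⟩⟩⟩

theorem isDomUltrafilter_preimage (h : A ⟶ B) {μ : Set B} (hμ : IsDomUltrafilter μ) :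
    IsDomUltrafilter {α : A | α ∈ domElts A ∧ h.toFun α ∈ μ} := by
  refine isDomUltrafilter_of (fun α h => h.1) ?_ ?_ ?_ ?_ ?_
  · refine ⟨antidom (zero A), antidom_mem _, ?_⟩
    rw [h.map_antidom, hμ.antidom_mem_iff (map_mem_domElts h zero_mem_domElts), map_zero]
    exact hμ.zero_notMem
  · rintro α ⟨hα, h1⟩ β ⟨hβ, h2⟩
    refine ⟨comp_mem_domElts hα hβ, ?_⟩
    rw [h.map_comp]
    exact hμ.inter h1 h2
  · rintro α ⟨hα, h1⟩ β hβ hle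
    exact ⟨hβ, hμ.up h1 (map_mem_domElts h hβ) (map_le h hle)⟩
  · rintro ⟨-, h1⟩
    exact hμ.zero_notMem (map_zero h ▸ h1)
  · intro α hα
    refine (hμ.compl (map_mem_domElts h hα)).imp (⟨hα, ·⟩) fun h1 => ⟨antidom_mem _, ?_⟩
    rwa [h.map_antidom]

/-! ## Prime filters -/

/-- The germ of `a` at `μ`. -/
def germ (μ : Set A) (a : A) : Set A := {b | ∃ α ∈ μ, le (α ⬝ a) b}

/-- The target of a prime filter. -/
def target (P : Set A) : Set A := upClosure (domElts A) (rng '' P)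

/-- The composite of two prime filters. -/
def filterComp (P Q : Set A) : Set A := upClosure Set.univ (Set.image2 FunSig.comp P Q)


theorem IsDomUltrafilter.mem_germ {μ : Set A} (hμ : IsDomUltrafilter μ) (a : A) :
    a ∈ germ μ a := by
  obtain ⟨α, hα⟩ := hμ.nonempty
  exact ⟨α, hα, comp_le_of_mem (hμ.subset hα) a⟩

theorem IsDomUltrafilter.dom_image_germ {μ : Set A} (hμ : IsDomUltrafilter μ) {a : A}
    (ha : dom a ∈ μ) : dom '' germ μ a = μ := by
  apply Set.Subset.antisymm
  · rintro _ ⟨b, ⟨α, hα, h⟩, rfl⟩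
    refine hμ.up (hμ.inter hα ha) (dom_mem _) ?_
    rw [← dom_comp_dom (hμ.subset hα)]
    exact dom_mono h
  · intro α hα
    -- Extending `α ⬝ a` by the identity on the rest of `α` gives domain exactly `α`.
    refine ⟨pref (α ⬝ a) α, ⟨α, hα, le_pref_left _ _⟩, dom_pref_of_le (hμ.subset hα) ?_⟩
    rw [dom_comp_dom (hμ.subset hα)]
    exact comp_le_left (dom_mem _)

/-- Primeness holds because `μ` decides `dom b`: on `dom b` the union `pref b c` agrees with `b`,
and off it with `c`. -/
theorem IsDomUltrafilter.isPrimeFilter_germ {μ : Set A} (hμ : IsDomUltrafilter μ) {a : A}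
    (ha : dom a ∈ μ) : IsPrimeFilter (germ μ a) := by
  refine ⟨⟨fun _ _ => trivial, ⟨a, hμ.mem_germ a⟩, ?_, ?_⟩, ?_, ?_⟩
  · rintro b ⟨α, hα, h⟩ c - h'
    exact ⟨α, hα, le.trans h h'⟩
  · rintro b ⟨α, hα, h⟩ c ⟨β, hβ, h'⟩
    refine ⟨α ⬝ β ⬝ a, ⟨_, hμ.inter hα hβ, le.refl _⟩, le.trans ?_ h, le.trans ?_ h'⟩
    · exact comp_le_comp (comp_le_left (hμ.subset hβ)) (le.refl _)
    · exact comp_le_comp (comp_le_of_mem (hμ.subset hα) _) (le.refl _)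
  · intro h
    have h0 : dom (zero A) ∈ dom '' germ μ a := ⟨_, h ▸ trivial, rfl⟩
    rw [hμ.dom_image_germ ha, dom_eq zero_mem_domElts] at h0
    exact hμ.zero_notMem h0
  · rintro b c ⟨α, hα, h⟩
    rcases hμ.compl (dom_mem b) with hb | hb
    · refine Or.inl ⟨_, hμ.inter hb hα, ?_⟩
      rw [comp_assoc]
      have := comp_le_comp (le.refl (dom b)) h
      rwa [dom_pref_comp] at this
    · rw [antidom_dom] at hb
      refine Or.inr ⟨_, hμ.inter hb hα, ?_⟩
      rw [comp_assoc]
      exact le.trans (comp_le_comp (le.refl _) h) (antidom_comp_pref_le b c)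

namespace IsPrimeFilter

variable {P Q R : Set A}

theorem up (hP : IsPrimeFilter P) {a b : A} (ha : a ∈ P) (h : le a b) : b ∈ P :=
  hP.filter.up a ha b trivial h

theorem zero_notMem (hP : IsPrimeFilter P) : zero A ∉ P := fun h =>
  hP.proper (Set.eq_univ_of_forall fun a => hP.up h (zero_le a))

/-- A common lower bound `c` of `b` and `a` in `P` equals `dom c ⬝ c`, which lies below `dom b ⬝ a`.
-/
theorem comp_mem (hP : IsPrimeFilter P) {α a : A} (hα : α ∈ dom '' P) (ha : a ∈ P) :
    α ⬝ a ∈ P := by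
  obtain ⟨b, hb, rfl⟩ := hα
  obtain ⟨c, hc, h, h'⟩ := hP.filter.down b hb a ha
  exact hP.up hc (dom_comp_self c ▸ comp_le_comp (dom_mono h) h')

/-- Any `a ∈ P` is the preferential union of its restrictions to `α` and to the complement, so
primeness decides `α`. -/
theorem isDomUltrafilter_source (hP : IsPrimeFilter P) : IsDomUltrafilter (dom '' P) := by
  refine isDomUltrafilter_of ?_ (hP.filter.nonempty.image _) ?_ ?_ ?_ ?_
  · rintro _ ⟨a, -, rfl⟩
    exact dom_mem a
  · rintro α hα _ ⟨b, hb, rfl⟩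
    have : α ∈ domElts A := by
      obtain ⟨a, -, rfl⟩ := hα
      exact dom_mem a
    rw [← dom_comp_dom this]
    exact ⟨_, hP.comp_mem hα hb, rfl⟩
  · rintro _ ⟨a, ha, rfl⟩ β hβ h
    exact ⟨pref a β, hP.up ha (le_pref_left _ _), dom_pref_of_le hβ h⟩
  · rintro ⟨a, ha, h⟩
    exact hP.zero_notMem (dom_eq_zero h ▸ ha)
  · intro α hα
    obtain ⟨a, ha⟩ := hP.filter.nonempty
    have key : ∀ β ∈ domElts A, β ⬝ a ∈ P → β ∈ dom '' P := fun β hβ h =>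
      ⟨pref (β ⬝ a) β, hP.up h (le_pref_left _ _), dom_pref_of_le hβ
        (dom_comp_dom hβ (a := a) ▸ comp_le_left (dom_mem _))⟩
    exact (hP.prime _ _ ((pref_split hα a).symm ▸ ha)).imp (key _ hα) (key _ (antidom_mem _))

theorem isDomUltrafilter_target (hP : IsPrimeFilter P) : IsDomUltrafilter (target P) := by
  obtain ⟨a, ha⟩ := hP.filter.nonempty
  refine isDomUltrafilter_of (fun _ h => h.1) ⟨_, rng_mem a, _, ⟨a, ha, rfl⟩, le.refl _⟩
    ?_ ?_ ?_ ?_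
  · rintro α ⟨hα, _, ⟨b, hb, rfl⟩, h⟩ β ⟨hβ, _, ⟨c, hc, rfl⟩, h'⟩
    obtain ⟨d, hd, h1, h2⟩ := hP.filter.down b hb c hc
    exact ⟨comp_mem_domElts hα hβ, _, ⟨d, hd, rfl⟩, le_comp (rng_mem d)
      (le.trans (rng_mono h1) h) (le.trans (rng_mono h2) h')⟩
  · rintro α ⟨hα, b, hb, h⟩ β hβ h'
    exact ⟨hβ, b, hb, le.trans h h'⟩
  · rintro ⟨-, _, ⟨b, hb, rfl⟩, h⟩
    exact hP.zero_notMem (rng_eq_zero (le.antisymm h (zero_le _)) ▸ hb)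
  · intro α hα
    exact (hP.prime _ _ ((pref_split_right hα a).symm ▸ ha)).imp
      (fun h => ⟨hα, _, ⟨_, h, rfl⟩, rng_comp_le_of_mem hα⟩)
      (fun h => ⟨antidom_mem _, _, ⟨_, h, rfl⟩, rng_comp_le_of_mem (antidom_mem _)⟩)

/-- A common lower bound of `a` and `b` in `P` is a restriction of `a` to its own domain, and that
domain lies in the source. -/
theorem eq_germ (hP : IsPrimeFilter P) {a : A} (ha : a ∈ P) : P = germ (dom '' P) a := by
  apply Set.Subset.antisymm
  · intro b hb
    obtain ⟨c, hc, h1, h2⟩ := hP.filter.down a ha b hb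
    refine ⟨dom c, ⟨c, hc, rfl⟩, ?_⟩
    rwa [show dom c ⬝ a = c from h1]
  · rintro b ⟨α, hα, h⟩
    exact hP.up (hP.comp_mem hα ha) h

/-- Prime filters with the same source that meet are equal. -/
theorem eq_of_mem (hP : IsPrimeFilter P) (hQ : IsPrimeFilter Q) (h : dom '' P = dom '' Q) {a : A}
    (ha : a ∈ P) (ha' : a ∈ Q) : P = Q := by
  rw [hP.eq_germ ha, hQ.eq_germ ha', h]

theorem rng_mem_target (_ : IsPrimeFilter P) {a : A} (ha : a ∈ P) : rng a ∈ target P :=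
  ⟨rng_mem a, _, ⟨a, ha, rfl⟩, le.refl _⟩

theorem comp_mem_filterComp {P Q : Set A} {p q : A} (hp : p ∈ P) (hq : q ∈ Q) :
    p ⬝ q ∈ filterComp P Q := ⟨trivial, _, ⟨p, hp, q, hq, rfl⟩, le.refl _⟩

/-- Otherwise the restriction of `p` to the arguments where `p ⬝ q` is undefined lies in `P`. Its
range is then in the target, as is `dom q`, although the two are disjoint. -/
theorem dom_comp_mem (hP : IsPrimeFilter P) (h : target P = dom '' Q)
    {p q : A} (hp : p ∈ P) (hq : q ∈ Q) : dom (p ⬝ q) ∈ dom '' P := by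
  refine (hP.isDomUltrafilter_source.compl (dom_mem _)).resolve_right fun h0 => ?_
  have h1 := hP.rng_mem_target (hP.comp_mem h0 hp)
  have h2 : dom q ∈ target P := h ▸ ⟨q, hq, rfl⟩
  refine hP.isDomUltrafilter_target.zero_notMem ?_
  rw [← rng_comp_dom_eq_zero (a := antidom (dom (p ⬝ q)) ⬝ p) (b := q)]
  · exact hP.isDomUltrafilter_target.inter h1 h2
  · rw [antidom_dom]
    refine eq_zero fun x y => ?_
    simp only [maps_comp, maps_antidom]
    grind

/-- The composite is computed from arbitrary representatives; that it is prime, and its source, then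
follow from the facts on germs. -/
theorem filterComp_eq_germ (hP : IsPrimeFilter P) (hQ : IsPrimeFilter Q)
    (h : target P = dom '' Q) {p q : A} (hp : p ∈ P) (hq : q ∈ Q) :
    filterComp P Q = germ (dom '' P) (p ⬝ q) := by
  apply Set.Subset.antisymm
  · rintro c ⟨-, _, ⟨p', hp', q', hq', rfl⟩, hc⟩
    obtain ⟨p₁, hp₁, h1, h2⟩ := hP.filter.down p hp p' hp'
    obtain ⟨q₁, hq₁, h3, h4⟩ := hQ.filter.down q hq q' hq'
    refine ⟨_, hP.dom_comp_mem h hp₁ hq₁, le.trans ?_ hc⟩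
    rw [show dom (p₁ ⬝ q₁) ⬝ (p ⬝ q) = p₁ ⬝ q₁ from comp_le_comp h1 h3]
    exact comp_le_comp h2 h4
  · rintro c ⟨α, hα, hc⟩
    refine ⟨trivial, _, ⟨_, hP.comp_mem hα hp, q, hq, rfl⟩, ?_⟩
    rwa [comp_assoc]

theorem isPrimeFilter_filterComp (hP : IsPrimeFilter P) (hQ : IsPrimeFilter Q)
    (h : target P = dom '' Q) : IsPrimeFilter (filterComp P Q) := by
  obtain ⟨p, hp⟩ := hP.filter.nonempty
  obtain ⟨q, hq⟩ := hQ.filter.nonempty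
  rw [hP.filterComp_eq_germ hQ h hp hq]
  exact hP.isDomUltrafilter_source.isPrimeFilter_germ (hP.dom_comp_mem h hp hq)

theorem source_filterComp (hP : IsPrimeFilter P) (hQ : IsPrimeFilter Q)
    (h : target P = dom '' Q) : dom '' filterComp P Q = dom '' P := by
  obtain ⟨p, hp⟩ := hP.filter.nonempty
  obtain ⟨q, hq⟩ := hQ.filter.nonempty
  rw [hP.filterComp_eq_germ hQ h hp hq]
  exact hP.isDomUltrafilter_source.dom_image_germ (hP.dom_comp_mem h hp hq)

theorem target_filterComp (hP : IsPrimeFilter P) (hQ : IsPrimeFilter Q)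
    (h : target P = dom '' Q) : target (filterComp P Q) = target Q := by
  refine (hQ.isDomUltrafilter_target.eq_of_subset
    (hP.isPrimeFilter_filterComp hQ h).isDomUltrafilter_target ?_).symm
  rintro β ⟨hβ, _, ⟨q, hq, rfl⟩, hle⟩
  obtain ⟨p, hp⟩ := hP.filter.nonempty
  exact ⟨hβ, _, ⟨_, comp_mem_filterComp hp hq, rfl⟩, le.trans (rng_comp_le p q) hle⟩

end IsPrimeFilter

namespace IsDomUltrafilter

variable {μ : Set A}

theorem upClosure_eq_germ (hμ : IsDomUltrafilter μ) {α : A} (hα : α ∈ μ) :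
    upClosure Set.univ μ = germ μ α := by
  apply Set.Subset.antisymm
  · rintro b ⟨-, β, hβ, h⟩
    exact ⟨β, hβ, le.trans (comp_le_left (hμ.subset hα)) h⟩
  · rintro b ⟨β, hβ, h⟩
    exact ⟨trivial, _, hμ.inter hβ hα, h⟩

theorem mem_upClosure (_ : IsDomUltrafilter μ) {α : A} (hα : α ∈ μ) :
    α ∈ upClosure Set.univ μ := ⟨trivial, α, hα, le.refl α⟩

theorem isPrimeFilter_upClosure (hμ : IsDomUltrafilter μ) :
    IsPrimeFilter (upClosure Set.univ μ) := by
  obtain ⟨α, hα⟩ := hμ.nonempty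
  rw [hμ.upClosure_eq_germ hα]
  exact hμ.isPrimeFilter_germ (by rwa [dom_eq (hμ.subset hα)])

theorem source_upClosure (hμ : IsDomUltrafilter μ) : dom '' upClosure Set.univ μ = μ := by
  obtain ⟨α, hα⟩ := hμ.nonempty
  rw [hμ.upClosure_eq_germ hα]
  exact hμ.dom_image_germ (by rwa [dom_eq (hμ.subset hα)])

theorem target_upClosure (hμ : IsDomUltrafilter μ) : target (upClosure Set.univ μ) = μ := by
  refine (hμ.eq_of_subset hμ.isPrimeFilter_upClosure.isDomUltrafilter_target fun α hα =>
    ⟨hμ.subset hα, _, ⟨α, hμ.mem_upClosure hα, rfl⟩, ?_⟩).symm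
  have := mem_domElts_iff.1 (hμ.subset hα)
  simp only [le_iff, maps_rng]
  grind

/-- Every ultrafilter containing the range of `a` is the target of a prime filter
containing `a`. -/
theorem exists_target_eq (hμ : IsDomUltrafilter μ) {a : A} (ha : rng a ∈ μ) :
    ∃ P, IsPrimeFilter P ∧ a ∈ P ∧ target P = μ := by
  -- The source sought must contain the preimages under `a` of all members of `μ`. None is empty
  -- because `rng a ∈ μ`.
  have hex : ∃ ν, IsDomUltrafilter ν ∧ (fun β => dom (a ⬝ β)) '' μ ⊆ ν := by
    refine exists_isDomUltrafilter ?_ (hμ.nonempty.image _) ?_ ?_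
    · rintro _ ⟨β, -, rfl⟩
      exact dom_mem _
    · rintro _ ⟨β, hβ, rfl⟩ _ ⟨γ, hγ, rfl⟩
      exact ⟨_, hμ.inter hβ hγ, (dom_comp_dom_comp a (hμ.subset hβ)).symm⟩
    · rintro ⟨β, hβ, h⟩
      have h1 := rng_comp_dom_eq_zero (dom_eq_zero h)
      rw [dom_eq (hμ.subset hβ)] at h1
      exact hμ.zero_notMem (h1 ▸ hμ.inter ha hβ)
  obtain ⟨ν, hν, hs⟩ := hex
  have hda : dom a ∈ ν := hν.up (hs ⟨_, ha, rfl⟩) (dom_mem a) (dom_comp_le _ _)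
  have hP := hν.isPrimeFilter_germ hda
  refine ⟨germ ν a, hP, hν.mem_germ a, (hμ.eq_of_subset hP.isDomUltrafilter_target ?_).symm⟩
  intro β hβ
  exact ⟨hμ.subset hβ, _, ⟨_, ⟨_, hs ⟨β, hβ, rfl⟩, le.refl _⟩, rfl⟩, le.trans
    (rng_mono (dom_comp_comp_le a (hμ.subset hβ))) (rng_comp_le_of_mem (hμ.subset hβ))⟩

end IsDomUltrafilter

/-! ## The category of prime filters -/

/-- The space of ultrafilters of `D[A]`. -/
def DomUltrafilter (A : RepAlg.{u}) : Type u := {μ : Set A // IsDomUltrafilter μ}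

/-- The space of prime filters of `A`. -/
def PrimeFilter (A : RepAlg.{u}) : Type u := {P : Set A // IsPrimeFilter P}

/-! ### The topologies on ultrafilters and prime filters. -/

instance : TopologicalSpace (DomUltrafilter A) :=
  TopologicalSpace.generateFrom {U | ∃ α ∈ domElts A, U = {μ | α ∈ μ.1}}

instance : TopologicalSpace (PrimeFilter A) :=
  TopologicalSpace.generateFrom {U | ∃ a : A, U = {P | a ∈ P.1}}

theorem DomUltrafilter.isTopologicalBasis : TopologicalSpace.IsTopologicalBasis
    {U : Set (DomUltrafilter A) | ∃ α ∈ domElts A, U = {μ | α ∈ μ.1}} where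
  exists_subset_inter := by
    rintro _ ⟨α, hα, rfl⟩ _ ⟨β, hβ, rfl⟩ μ ⟨h1, h2⟩
    exact ⟨_, ⟨_, comp_mem_domElts hα hβ, rfl⟩, μ.2.inter h1 h2, fun ν hν =>
      ⟨ν.2.up hν hα (comp_le_left hβ), ν.2.up hν hβ (comp_le_of_mem hα _)⟩⟩
  sUnion_eq := by
    refine Set.eq_univ_of_forall fun μ => ?_
    obtain ⟨α, hα⟩ := μ.2.nonempty
    exact ⟨_, ⟨α, μ.2.subset hα, rfl⟩, hα⟩
  eq_generateFrom := rfl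

theorem PrimeFilter.isTopologicalBasis : TopologicalSpace.IsTopologicalBasis
    {U : Set (PrimeFilter A) | ∃ a : A, U = {P | a ∈ P.1}} where
  exists_subset_inter := by
    rintro _ ⟨a, rfl⟩ _ ⟨b, rfl⟩ P ⟨h1, h2⟩
    obtain ⟨c, hc, h3, h4⟩ := P.2.filter.down a h1 b h2
    exact ⟨_, ⟨c, rfl⟩, hc, fun Q hQ => ⟨Q.2.up hQ h3, Q.2.up hQ h4⟩⟩
  sUnion_eq := by
    refine Set.eq_univ_of_forall fun P => ?_
    obtain ⟨a, ha⟩ := P.2.filter.nonempty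
    exact ⟨_, ⟨a, rfl⟩, ha⟩
  eq_generateFrom := rfl

theorem DomUltrafilter.isOpen_mem {α : A} (hα : α ∈ domElts A) :
    IsOpen {μ : DomUltrafilter A | α ∈ μ.1} := isTopologicalBasis.isOpen ⟨α, hα, rfl⟩

theorem PrimeFilter.isOpen_mem (a : A) : IsOpen {P : PrimeFilter A | a ∈ P.1} :=
  isTopologicalBasis.isOpen ⟨a, rfl⟩

theorem DomUltrafilter.isClopen_mem {α : A} (hα : α ∈ domElts A) :
    IsClopen {μ : DomUltrafilter A | α ∈ μ.1} := by
  refine ⟨⟨?_⟩, isOpen_mem hα⟩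
  convert isOpen_mem (antidom_mem α) using 1
  ext μ
  exact (μ.2.antidom_mem_iff hα).symm

/-- An ultrafilter `U` on the space converges to the set of those `α` whose basic open set is
`U`-large. -/
instance : CompactSpace (DomUltrafilter A) := by
  refine ⟨isCompact_iff_ultrafilter_le_nhds.2 fun U _ => ?_⟩
  have hμ : IsDomUltrafilter {α : A | α ∈ domElts A ∧ {μ : DomUltrafilter A | α ∈ μ.1} ∈ U} := by
    refine isDomUltrafilter_of (fun α h => h.1) ?_ ?_ ?_ ?_ ?_
    · refine ⟨antidom (zero A), antidom_mem _, Filter.mem_of_superset Filter.univ_mem fun μ _ => ?_⟩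
      exact (μ.2.antidom_mem_iff zero_mem_domElts).2 μ.2.zero_notMem
    · rintro α ⟨hα, h1⟩ β ⟨hβ, h2⟩
      refine ⟨comp_mem_domElts hα hβ, ?_⟩
      filter_upwards [h1, h2] with μ h1 h2 using μ.2.inter h1 h2
    · rintro α ⟨hα, h1⟩ β hβ h
      refine ⟨hβ, ?_⟩
      filter_upwards [h1] with μ h1 using μ.2.up h1 hβ h
    · rintro ⟨-, h⟩
      obtain ⟨μ, hμ⟩ := U.nonempty_of_mem h
      exact μ.2.zero_notMem hμ
    · intro α hα
      by_cases h : {μ : DomUltrafilter A | α ∈ μ.1} ∈ U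
      · exact Or.inl ⟨hα, h⟩
      · refine Or.inr ⟨antidom_mem _, ?_⟩
        rw [← Ultrafilter.compl_mem_iff_notMem] at h
        filter_upwards [h] with μ h using (μ.2.antidom_mem_iff hα).2 h
  refine ⟨⟨_, hμ⟩, trivial, ?_⟩
  refine (TopologicalSpace.nhds_generateFrom (a := (⟨_, hμ⟩ : DomUltrafilter A))).symm ▸ ?_
  refine le_iInf₂ fun s hs => ?_
  obtain ⟨h1, α, hα, rfl⟩ := hs
  exact Filter.le_principal_iff.2 h1.2

instance : TotallySeparatedSpace (DomUltrafilter A) := by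
  refine totallySeparatedSpace_iff_exists_isClopen.2 fun μ ν h => ?_
  have : ¬ μ.1 ⊆ ν.1 := fun hs => h (Subtype.ext (μ.2.eq_of_subset ν.2 hs))
  obtain ⟨α, h1, h2⟩ := Set.not_subset.1 this
  exact ⟨_, DomUltrafilter.isClopen_mem (μ.2.subset h1), h1, h2⟩

namespace PrimeFilter

/-- The source of a prime filter. -/
def src (P : PrimeFilter A) : DomUltrafilter A := ⟨_, P.2.isDomUltrafilter_source⟩

/-- The target of a prime filter. -/
def tgt (P : PrimeFilter A) : DomUltrafilter A := ⟨_, P.2.isDomUltrafilter_target⟩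

/-- The identity at an ultrafilter. -/
def one (μ : DomUltrafilter A) : PrimeFilter A := ⟨_, μ.2.isPrimeFilter_upClosure⟩

/-- The prime filter at `μ` generated by an element whose domain is in `μ`. -/
def germ (μ : DomUltrafilter A) (a : A) (h : dom a ∈ μ.1) : PrimeFilter A :=
  ⟨_, μ.2.isPrimeFilter_germ h⟩

theorem mem_germ (μ : DomUltrafilter A) (a : A) (h : dom a ∈ μ.1) : a ∈ (germ μ a h).1 :=
  μ.2.mem_germ a

theorem src_germ (μ : DomUltrafilter A) (a : A) (h : dom a ∈ μ.1) : src (germ μ a h) = μ :=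
  Subtype.ext (μ.2.dom_image_germ h)

theorem dom_mem_src {P : PrimeFilter A} {a : A} (h : a ∈ P.1) : dom a ∈ P.src.1 := ⟨a, h, rfl⟩

theorem rng_mem_tgt {P : PrimeFilter A} {a : A} (h : a ∈ P.1) : rng a ∈ P.tgt.1 :=
  P.2.rng_mem_target h

/-- The composite of prime filters. -/
def comp (P Q : PrimeFilter A) (h : P.tgt = Q.src) : PrimeFilter A :=
  ⟨_, P.2.isPrimeFilter_filterComp Q.2 (congrArg Subtype.val h)⟩

theorem comp_mem_comp {P Q : PrimeFilter A} (h : P.tgt = Q.src) {p q : A} (hp : p ∈ P.1)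
    (hq : q ∈ Q.1) : p ⬝ q ∈ (comp P Q h).1 := IsPrimeFilter.comp_mem_filterComp hp hq

theorem src_one (μ : DomUltrafilter A) : src (one μ) = μ := Subtype.ext μ.2.source_upClosure

theorem tgt_one (μ : DomUltrafilter A) : tgt (one μ) = μ := Subtype.ext μ.2.target_upClosure

theorem mem_one {μ : DomUltrafilter A} {α : A} (h : α ∈ μ.1) : α ∈ (one μ).1 :=
  μ.2.mem_upClosure h

theorem src_comp (P Q : PrimeFilter A) (h : P.tgt = Q.src) : src (comp P Q h) = src P :=
  Subtype.ext (P.2.source_filterComp Q.2 (congrArg Subtype.val h))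

theorem tgt_comp (P Q : PrimeFilter A) (h : P.tgt = Q.src) : tgt (comp P Q h) = tgt Q :=
  Subtype.ext (P.2.target_filterComp Q.2 (congrArg Subtype.val h))

/-- The uniqueness of germs in working form: category laws, star injectivity and functoriality
reduce to exhibiting one common member. -/
theorem ext_of_mem {P Q : PrimeFilter A} (h : P.src = Q.src) {a : A} (ha : a ∈ P.1)
    (ha' : a ∈ Q.1) : P = Q :=
  Subtype.ext (P.2.eq_of_mem Q.2 (congrArg Subtype.val h) ha ha')

theorem continuous_src : Continuous (src (A := A)) := by
  refine continuous_generateFrom_iff.2 ?_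
  rintro _ ⟨α, hα, rfl⟩
  refine isOpen_iff_forall_mem_open.2 ?_
  rintro P ⟨a, ha, rfl⟩
  exact ⟨_, fun Q hQ => dom_mem_src hQ, isOpen_mem a, ha⟩

theorem continuous_tgt : Continuous (tgt (A := A)) := by
  refine continuous_generateFrom_iff.2 ?_
  rintro _ ⟨α, hα, rfl⟩
  refine isOpen_iff_forall_mem_open.2 ?_
  rintro P ⟨-, _, ⟨a, ha, rfl⟩, h⟩
  exact ⟨_, fun Q hQ => Q.tgt.2.up (rng_mem_tgt hQ) hα h, isOpen_mem a, ha⟩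

theorem continuous_one : Continuous (one (A := A)) := by
  refine continuous_generateFrom_iff.2 ?_
  rintro _ ⟨a, rfl⟩
  refine isOpen_iff_forall_mem_open.2 ?_
  rintro μ ⟨-, α, hα, h⟩
  exact ⟨_, fun ν hν => ⟨trivial, α, hν, h⟩, DomUltrafilter.isOpen_mem (μ.2.subset hα), hα⟩

theorem continuous_comp : Continuous
    (fun p : {p : PrimeFilter A × PrimeFilter A // tgt p.1 = src p.2} => comp p.1.1 p.1.2 p.2) := by
  refine continuous_generateFrom_iff.2 ?_
  rintro _ ⟨a, rfl⟩
  refine isOpen_iff_forall_mem_open.2 ?_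
  rintro p ⟨-, _, ⟨b, hb, c, hc, rfl⟩, h⟩
  exact ⟨_, fun q hq => ⟨trivial, _, ⟨b, hq.1, c, hq.2, rfl⟩, h⟩,
    ((isOpen_mem b).prod (isOpen_mem c)).preimage continuous_subtype_val, hb, hc⟩

theorem src_image (a : A) : src '' {P | a ∈ P.1} = {μ | dom a ∈ μ.1} := by
  ext μ
  constructor
  · rintro ⟨P, hP, rfl⟩
    exact dom_mem_src hP
  · exact fun h => ⟨germ μ a h, mem_germ _ _ h, src_germ _ _ h⟩

/-- Besides openness of the target map, this yields the range operation on basic sets and the star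
condition at targets. -/
theorem tgt_image (a : A) : tgt '' {P | a ∈ P.1} = {μ | rng a ∈ μ.1} := by
  ext μ
  constructor
  · rintro ⟨P, hP, rfl⟩
    exact rng_mem_tgt hP
  · intro h
    obtain ⟨P, hP, ha, h⟩ := μ.2.exists_target_eq h
    exact ⟨⟨P, hP⟩, ha, Subtype.ext h⟩

theorem isOpenMap_src : IsOpenMap (src (A := A)) := by
  refine isTopologicalBasis.isOpenMap_iff.2 ?_
  rintro _ ⟨a, rfl⟩
  rw [src_image]
  exact DomUltrafilter.isOpen_mem (dom_mem a)

theorem isOpenMap_tgt : IsOpenMap (tgt (A := A)) := by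
  refine isTopologicalBasis.isOpenMap_iff.2 ?_
  rintro _ ⟨a, rfl⟩
  rw [tgt_image]
  exact DomUltrafilter.isOpen_mem (rng_mem a)

theorem isLocalHomeomorph_src : IsLocalHomeomorph (src (A := A)) := by
  refine isLocalHomeomorph_iff_isOpenEmbedding_restrict.2 fun P => ?_
  obtain ⟨a, ha⟩ := P.2.filter.nonempty
  refine ⟨_, (isOpen_mem a).mem_nhds ha, .of_continuous_injective_isOpenMap ?_ ?_ ?_⟩
  · exact continuous_src.comp continuous_subtype_val
  · rintro ⟨Q, hQ⟩ ⟨R, hR⟩ h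
    exact Subtype.ext (ext_of_mem h hQ hR)
  · exact isOpenMap_src.comp (isOpen_mem a).isOpenMap_subtype_val

/-- Restricting `p` to the domain of a common lower bound of `p ⬝ q` and `p ⬝ r` makes the two
composites equal. Hence `q` and `r` agree on the range of the restriction, which lies in the common
source of `Q` and `R`. -/
theorem comp_left_cancel {P Q R : PrimeFilter A} (h : P.tgt = Q.src) (h' : P.tgt = R.src)
    (heq : comp P Q h = comp P R h') : Q = R := by
  obtain ⟨p, hp⟩ := P.2.filter.nonempty
  obtain ⟨q, hq⟩ := Q.2.filter.nonempty
  obtain ⟨r, hr⟩ := R.2.filter.nonempty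
  obtain ⟨d, hd, h1, h2⟩ := (comp P Q h).2.filter.down _ (comp_mem_comp h hp hq) _
    (heq ▸ comp_mem_comp h' hp hr)
  have hd' : dom d ∈ P.src.1 := src_comp P Q h ▸ dom_mem_src hd
  have key : rng (dom d ⬝ p) ⬝ q = rng (dom d ⬝ p) ⬝ r := by
    apply rng_comp_eq
    rw [comp_assoc, comp_assoc, show dom d ⬝ (p ⬝ q) = d from h1,
      show dom d ⬝ (p ⬝ r) = d from h2]
  have ht := rng_mem_tgt (P.2.comp_mem hd' hp)
  refine ext_of_mem (h.symm.trans h') (Q.2.comp_mem ?_ hq) (key ▸ R.2.comp_mem ?_ hr)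
  · exact (Set.ext_iff.1 (congrArg Subtype.val h) _).1 ht
  · exact (Set.ext_iff.1 (congrArg Subtype.val h') _).1 ht

end PrimeFilter

open PrimeFilter in
/-- The category of prime filters of `A`. -/
def primeFilterCat (A : RepAlg.{u}) : StoneEtaleCat.{u} where
  Obj := DomUltrafilter A
  Arr := PrimeFilter A
  src := src
  tgt := tgt
  one := one
  comp := PrimeFilter.comp
  src_one := src_one
  tgt_one := tgt_one
  src_comp := src_comp
  tgt_comp := tgt_comp
  one_comp P := by
    obtain ⟨p, hp⟩ := P.2.filter.nonempty
    refine ext_of_mem (by rw [src_comp, src_one]) (a := p) ?_ hp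
    have := comp_mem_comp (tgt_one _) (mem_one (dom_mem_src hp)) hp
    rwa [dom_comp_self] at this
  comp_one P := by
    obtain ⟨p, hp⟩ := P.2.filter.nonempty
    refine ext_of_mem (src_comp _ _ _) (a := p) ?_ hp
    have := comp_mem_comp (src_one _).symm hp (mem_one (rng_mem_tgt hp))
    rwa [comp_rng_self] at this
  assoc P Q R h h' := by
    obtain ⟨p, hp⟩ := P.2.filter.nonempty
    obtain ⟨q, hq⟩ := Q.2.filter.nonempty
    obtain ⟨r, hr⟩ := R.2.filter.nonempty
    refine ext_of_mem (by simp only [src_comp]) (a := p ⬝ q ⬝ r) ?_ ?_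
    · exact comp_mem_comp _ (comp_mem_comp _ hp hq) hr
    · rw [comp_assoc]
      exact comp_mem_comp _ hp (comp_mem_comp _ hq hr)
  continuous_src := continuous_src
  continuous_tgt := continuous_tgt
  continuous_one := continuous_one
  continuous_comp := continuous_comp
  compact := inferInstanceAs (CompactSpace (DomUltrafilter A))
  totallySeparated := inferInstanceAs (TotallySeparatedSpace (DomUltrafilter A))
  localHomeo_src := isLocalHomeomorph_src
  openMap_tgt := isOpenMap_tgt
  epi _ _ _ := comp_left_cancel

theorem isPrimeFilterCategory_primeFilterCat (A : RepAlg.{u}) :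
    IsPrimeFilterCategory A (primeFilterCat A).toTopologicalCategory (Equiv.refl _)
      (Equiv.refl _) where
  src_eq _ := rfl
  tgt_eq _ := rfl
  one_eq _ := rfl
  comp_eq _ _ _ := rfl
  topObj_eq := rfl
  topArr_eq := rfl

/-! ## The multivalued functor of a homomorphism -/

/-- Inverse image of ultrafilters. -/
def DomUltrafilter.preimage (h : A ⟶ B) (μ : DomUltrafilter B) : DomUltrafilter A :=
  ⟨_, isDomUltrafilter_preimage h μ.2⟩

theorem DomUltrafilter.continuous_preimage (h : A ⟶ B) :
    Continuous (DomUltrafilter.preimage h) := by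
  refine continuous_generateFrom_iff.2 ?_
  rintro _ ⟨α, hα, rfl⟩
  convert DomUltrafilter.isOpen_mem (map_mem_domElts h hα) using 1
  exact Set.ext fun μ => and_iff_right hα

namespace PrimeFilter

theorem src_of_subset (h : A ⟶ B) {P : PrimeFilter B} {Q : PrimeFilter A}
    (hs : Q.1 ⊆ h.toFun ⁻¹' P.1) : Q.src = P.src.preimage h := by
  refine Subtype.ext (Q.src.2.eq_of_subset (P.src.preimage h).2 ?_)
  rintro _ ⟨a, ha, rfl⟩
  exact ⟨dom_mem a, map_dom h a ▸ dom_mem_src (hs ha)⟩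

theorem tgt_of_subset (h : A ⟶ B) {P : PrimeFilter B} {Q : PrimeFilter A}
    (hs : Q.1 ⊆ h.toFun ⁻¹' P.1) : Q.tgt = P.tgt.preimage h := by
  refine Subtype.ext (Q.tgt.2.eq_of_subset (P.tgt.preimage h).2 ?_)
  rintro β ⟨hβ, _, ⟨a, ha, rfl⟩, hle⟩
  exact ⟨hβ, map_mem_domElts h hβ, _, ⟨_, hs ha, rfl⟩, h.map_rng a ▸ map_le h hle⟩

/-- If `h a ∈ P` then some prime filter containing `a` is included in the inverse image of `P`. -/
theorem exists_subset_preimage (h : A ⟶ B) {P : PrimeFilter B} {a : A} (ha : h.toFun a ∈ P.1) :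
    ∃ Q : PrimeFilter A, a ∈ Q.1 ∧ Q.1 ⊆ h.toFun ⁻¹' P.1 := by
  have hd : dom a ∈ (P.src.preimage h).1 := ⟨dom_mem a, map_dom h a ▸ dom_mem_src ha⟩
  refine ⟨germ _ a hd, mem_germ _ _ _, ?_⟩
  rintro b ⟨α, hα, hle⟩
  refine P.2.up (P.2.comp_mem hα.2 ha) ?_
  rw [← h.map_comp]
  exact map_le h hle

theorem exists_subset_preimage_iff (h : A ⟶ B) {P : PrimeFilter B} {a : A} :
    (∃ Q : PrimeFilter A, a ∈ Q.1 ∧ Q.1 ⊆ h.toFun ⁻¹' P.1) ↔ h.toFun a ∈ P.1 :=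
  ⟨fun ⟨_, ha, hs⟩ => hs ha, exists_subset_preimage h⟩

/-- `P` is the germ of `h a` at `μ`. Some prime filter containing `a` is related to it, and by its
source this filter is `Q`. -/
theorem exists_src_eq_and_subset (h : A ⟶ B) {μ : DomUltrafilter B} {Q : PrimeFilter A}
    (hs : Q.src = μ.preimage h) :
    ∃ P : PrimeFilter B, P.src = μ ∧ Q.1 ⊆ h.toFun ⁻¹' P.1 := by
  obtain ⟨a, ha⟩ := Q.2.filter.nonempty
  have hd : dom (h.toFun a) ∈ μ.1 := by
    rw [← map_dom]
    have h1 : dom a ∈ (μ.preimage h).1 := hs ▸ dom_mem_src ha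
    exact h1.2
  refine ⟨germ μ _ hd, src_germ _ _ hd, ?_⟩
  obtain ⟨Q', h1, h2⟩ := exists_subset_preimage h (mem_germ μ _ hd)
  have h3 := src_of_subset h h2
  rw [src_germ, ← hs] at h3
  rwa [ext_of_mem h3.symm ha h1]

/-- A basic neighbourhood of `Q` retains only one member `a`. A germ of `h a` with target `μ`
exists, but the filter related to it contains `a` and need not be `Q`. -/
theorem exists_tgt_eq_and_subset (h : A ⟶ B) {μ : DomUltrafilter B} {U : Set (PrimeFilter A)}
    (hU : IsOpen U) {Q : PrimeFilter A} (hQU : Q ∈ U) (hQ : Q.tgt = μ.preimage h) :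
    ∃ P : PrimeFilter B, P.tgt = μ ∧ ∃ Q ∈ U, Q.1 ⊆ h.toFun ⁻¹' P.1 := by
  obtain ⟨_, ⟨a, rfl⟩, ha, hs⟩ := isTopologicalBasis.exists_subset_of_mem_open hQU hU
  have h1 : rng a ∈ (μ.preimage h).1 := hQ ▸ rng_mem_tgt ha
  have h2 : μ ∈ tgt '' {P | h.toFun a ∈ P.1} := by
    rw [tgt_image, ← h.map_rng]
    exact h1.2
  obtain ⟨P, hP, hPμ⟩ := h2
  obtain ⟨Q', h3, h4⟩ := exists_subset_preimage h hP
  exact ⟨P, hPμ, Q', hs h3, h4⟩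

end PrimeFilter

open PrimeFilter in
/-- The multivalued functor of inverse images under a homomorphism. -/
def primeFilterMap (h : A ⟶ B) : primeFilterCat B ⟶ primeFilterCat A where
  obj := DomUltrafilter.preimage h
  rel P Q := Q.1 ⊆ h.toFun ⁻¹' P.1
  rel_src _ _ := src_of_subset h
  rel_tgt _ _ := tgt_of_subset h
  rel_one μ := by
    rintro a ⟨-, α, hα, hle⟩
    exact ⟨trivial, _, hα.2, map_le h hle⟩
  rel_comp P₁ P₂ Q₁ Q₂ _ _ h₁ h₂ := by
    rintro _ ⟨-, _, ⟨p, hp, q, hq, rfl⟩, hle⟩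
    exact ⟨trivial, _, ⟨_, h₁ hp, _, h₂ hq, rfl⟩, h.map_comp p q ▸ map_le h hle⟩
  continuous_obj := DomUltrafilter.continuous_preimage h
  continuous_rel U hU := by
    refine isOpen_iff_forall_mem_open.2 ?_
    rintro P ⟨Q, hQU, hQ⟩
    obtain ⟨_, ⟨a, rfl⟩, ha, hs⟩ := isTopologicalBasis.exists_subset_of_mem_open hQU hU
    refine ⟨_, fun P' hP' => ?_, isOpen_mem (h.toFun a), hQ ha⟩
    obtain ⟨Q', h1, h2⟩ := exists_subset_preimage h hP'
    exact ⟨Q', hs h1, h2⟩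
  coherent :=
    { starInjective := by
        intro P₁ P₂ Q hs h₁ h₂
        obtain ⟨a, ha⟩ := Q.2.filter.nonempty
        exact ext_of_mem hs (h₁ ha) (h₂ ha)
      starSurjective := fun _ _ => exists_src_eq_and_subset h
      coPseudoStarSurjective := fun _ _ hU ⟨_, hQU, hQ⟩ => exists_tgt_eq_and_subset h hU hQU hQ }

/-- The functor of prime filters. -/
def primeFilterFunctor : RepAlg.{u}ᵒᵖ ⥤ StoneEtaleCat.{u} where
  obj A := primeFilterCat A.unop
  map h := primeFilterMap h.unop
  map_id A := by
    apply StarCoherentFunctor.ext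
    · funext μ
      exact Subtype.ext (Set.ext fun α => ⟨fun h => h.2, fun h => ⟨μ.2.subset h, h⟩⟩)
    · funext P Q
      refine propext ⟨fun h => ?_, fun h => h ▸ subset_rfl⟩
      obtain ⟨a, ha⟩ := Q.2.filter.nonempty
      refine PrimeFilter.ext_of_mem (Subtype.ext ?_) (h ha) ha
      exact (Q.src.2.eq_of_subset P.src.2 (Set.image_mono h)).symm
  map_comp {A B C} h k := by
    apply StarCoherentFunctor.ext
    · funext μ
      exact Subtype.ext (Set.ext fun α =>
        ⟨fun h' => ⟨h'.1, map_mem_domElts _ h'.1, h'.2⟩, fun h' => ⟨h'.1, h'.2.2⟩⟩)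
    · funext P Q
      refine propext ⟨fun hs => ?_, fun ⟨R, h1, h2⟩ => h2.trans (Set.preimage_mono h1)⟩
      obtain ⟨a, ha⟩ := Q.2.filter.nonempty
      -- The intermediate filter `R` is chosen through a member `a` of `Q`; the filter `Q'` reached
      -- through it shares `a` and the source with `Q`.
      obtain ⟨R, h1, h2⟩ := PrimeFilter.exists_subset_preimage h.unop (hs ha)
      obtain ⟨Q', h3, h4⟩ := PrimeFilter.exists_subset_preimage k.unop h1
      refine ⟨R, h2, ?_⟩
      have hs' : Q'.1 ⊆ (k.unop ≫ h.unop).toFun ⁻¹' P.1 := h4.trans (Set.preimage_mono h2)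
      rwa [PrimeFilter.ext_of_mem ((PrimeFilter.src_of_subset _ hs).trans
        (PrimeFilter.src_of_subset _ hs').symm) ha h3]

theorem isPrimeFilterFunctor_primeFilterFunctor :
    IsPrimeFilterFunctor primeFilterFunctor.{u} :=
  ⟨fun _ => Equiv.refl _, fun _ => Equiv.refl _, isPrimeFilterCategory_primeFilterCat,
    fun _ _ _ => ⟨fun _ => rfl, fun _ _ => Iff.rfl⟩⟩

/-! ## Sections over clopen sets -/

attribute [instance] StoneEtaleCat.compact StoneEtaleCat.totallySeparated

namespace TopologicalCategory

variable {C : TopologicalCategory.{u}}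

theorem comp_congr {f f' g g' : C.Arr} (hf : f = f') (hg : g = g') (h : C.tgt f = C.src g) :
    C.comp f g h = C.comp f' g' (by rw [← hf, ← hg, h]) := by
  subst hf hg
  rfl

theorem one_comp' {x : C.Obj} {f : C.Arr} (h : C.tgt (C.one x) = C.src f) :
    C.comp (C.one x) f h = f := by
  rw [tgt_one] at h
  subst h
  exact C.one_comp f

theorem comp_one' {x : C.Obj} {f : C.Arr} (h : C.tgt f = C.src (C.one x)) :
    C.comp f (C.one x) h = f := by
  rw [src_one] at h
  subst h
  exact C.comp_one f

theorem src_image_one (V : Set C.Obj) : C.src '' (C.one '' V) = V := by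
  simp [Set.image_image, C.src_one]

theorem mem_setAntidom {S : Set C.Arr} {f : C.Arr} :
    f ∈ C.setAntidom S ↔ f = C.one (C.src f) ∧ C.src f ∉ C.src '' S := by
  constructor
  · rintro ⟨x, hx, rfl⟩
    rw [C.src_one]
    exact ⟨rfl, hx⟩
  · rintro ⟨h, h'⟩
    exact ⟨_, h', h.symm⟩

theorem mem_setRng {S : Set C.Arr} {f : C.Arr} :
    f ∈ C.setRng S ↔ f = C.one (C.src f) ∧ C.src f ∈ C.tgt '' S := by
  constructor
  · rintro ⟨x, hx, rfl⟩
    rw [C.src_one]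
    exact ⟨rfl, hx⟩
  · rintro ⟨h, h'⟩
    exact ⟨_, h', h.symm⟩

/-- Composing with a set of identities restricts sources. -/
theorem setComp_one_image (V : Set C.Obj) (T : Set C.Arr) :
    C.setComp (C.one '' V) T = {f | f ∈ T ∧ C.src f ∈ V} := by
  ext f
  constructor
  · rintro ⟨_, ⟨x, hx, rfl⟩, g, hg, h, rfl⟩
    rw [one_comp']
    rw [C.tgt_one] at h
    exact ⟨hg, h ▸ hx⟩
  · rintro ⟨hf, hV⟩
    exact ⟨_, ⟨_, hV, rfl⟩, f, hf, C.tgt_one _, (C.one_comp f).symm⟩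

theorem setAntidom_setAntidom (S : Set C.Arr) :
    C.setAntidom (C.setAntidom S) = C.one '' (C.src '' S) := by
  unfold setAntidom
  rw [src_image_one, compl_compl]

theorem mem_setPref {S T : Set C.Arr} {f : C.Arr} :
    f ∈ C.setPref S T ↔ f ∈ S ∨ C.src f ∉ C.src '' S ∧ f ∈ T := by
  unfold setPref setAntidom
  rw [setComp_one_image, Set.mem_union, and_comm (b := f ∈ T)]
  rfl

end TopologicalCategory

open TopologicalCategory

namespace StoneEtaleCat

variable {C : StoneEtaleCat.{u}}

/-- A continuous section of a local homeomorphism over an open set is an open embedding. Conversely,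
the source map is an open embedding on an open set where it is injective, and its inverse is the
section. -/
theorem isClopenSection_iff {S : Set C.Arr} :
    C.IsClopenSection S ↔ IsOpen S ∧ Set.InjOn C.src S ∧ IsClopen (C.src '' S) := by
  constructor
  · rintro ⟨U, f, hU, hf, hs, rfl⟩
    have hsf : C.src ∘ f = Subtype.val := funext hs
    have ho : Topology.IsOpenEmbedding f := C.localHomeo_src.isOpenEmbedding_of_comp
      (hsf ▸ hU.isOpen.isOpenEmbedding_subtypeVal) hf
    refine ⟨ho.isOpen_range, ?_, ?_⟩
    · rintro _ ⟨x, rfl⟩ _ ⟨y, rfl⟩ h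
      rw [hs, hs] at h
      rw [Subtype.ext h]
    · rwa [← Set.range_comp, hsf, Subtype.range_val]
  · rintro ⟨hS, hinj, hcl⟩
    have ho : Topology.IsOpenEmbedding (S.domRestrict C.src) :=
      .of_continuous_injective_isOpenMap (C.continuous_src.comp continuous_subtype_val)
        (Set.injOn_iff_injective.1 hinj) (C.localHomeo_src.isOpenMap.comp hS.isOpenMap_subtype_val)
    let e := ho.toIsEmbedding.toHomeomorph
    refine ⟨Set.range (S.domRestrict C.src), fun x => (e.symm x).1, ?_, ?_, ?_, ?_⟩
    · rwa [Set.range_domRestrict]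
    · exact continuous_subtype_val.comp e.symm.continuous
    · exact fun x => congrArg Subtype.val (e.apply_symm_apply x)
    · ext f
      constructor
      · exact fun hf => ⟨e ⟨f, hf⟩, congrArg Subtype.val (e.symm_apply_apply ⟨f, hf⟩)⟩
      · rintro ⟨x, rfl⟩
        exact (e.symm x).2

theorem isClopenSection_one_image {V : Set C.Obj} (hV : IsClopen V) :
    C.IsClopenSection (C.one '' V) :=
  ⟨V, fun x => C.one x, hV, C.continuous_one.comp continuous_subtype_val, fun _ => C.src_one _,
    by rw [Set.image_eq_range]⟩

theorem isClopenSection_setAntidom {S : Set C.Arr} (hS : C.IsClopenSection S) :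
    C.IsClopenSection (C.setAntidom S) :=
  isClopenSection_one_image (isClopenSection_iff.1 hS).2.2.compl

/-- The set of targets is open because the target map is open, and closed because it is a continuous
image of a compact clopen set. -/
theorem isClopenSection_setRng {S : Set C.Arr} (hS : C.IsClopenSection S) :
    C.IsClopenSection (C.setRng S) := by
  refine isClopenSection_one_image ⟨?_, C.openMap_tgt _ (isClopenSection_iff.1 hS).1⟩
  obtain ⟨U, f, hU, hf, -, rfl⟩ := hS
  have := isCompact_iff_compactSpace.1 hU.isClosed.isCompact
  exact ((isCompact_range hf).image C.continuous_tgt).isClosed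

theorem isClopenSection_setComp {S T : Set C.Arr} (hS : C.IsClopenSection S)
    (hT : C.IsClopenSection T) : C.IsClopenSection (C.setComp S T) := by
  obtain ⟨U, f, hU, hf, hsf, rfl⟩ := hS
  obtain ⟨V, g, hV, hg, hsg, rfl⟩ := hT
  let W : Set U := {x | C.tgt (f x) ∈ V}
  have hW : IsClopen W := hV.preimage (C.continuous_tgt.comp hf)
  have hU' : ∀ x : Subtype.val '' W, x.1 ∈ U := by
    rintro ⟨_, x, -, rfl⟩
    exact x.2
  have hV' : ∀ x : Subtype.val '' W, C.tgt (f ⟨x, hU' x⟩) ∈ V := by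
    rintro ⟨_, x, hx, rfl⟩
    exact hx
  have hf' : Continuous fun x : Subtype.val '' W => f ⟨x, hU' x⟩ :=
    hf.comp (continuous_subtype_val.subtype_mk _)
  have hg' : Continuous fun x : Subtype.val '' W => g ⟨_, hV' x⟩ :=
    hg.comp ((C.continuous_tgt.comp hf').subtype_mk _)
  have hc : ∀ x : Subtype.val '' W, C.tgt (f ⟨x, hU' x⟩) = C.src (g ⟨_, hV' x⟩) :=
    fun x => (hsg ⟨_, hV' x⟩).symm
  refine ⟨Subtype.val '' W, fun x => C.comp _ _ (hc x), ⟨hU.isClosed.isClosedMap_subtype_val _ hW.1,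
    hU.isOpen.isOpenMap_subtype_val _ hW.2⟩, ?_, ?_, ?_⟩
  · exact C.continuous_comp.comp ((hf'.prodMk hg').subtype_mk hc)
  · exact fun x => (C.src_comp _ _ _).trans (hsf _)
  · ext k
    constructor
    · rintro ⟨_, ⟨x, rfl⟩, _, ⟨y, rfl⟩, h, rfl⟩
      have hy : C.tgt (f x) = y := h.trans (hsg y)
      refine ⟨⟨x, x, ?_, rfl⟩, comp_congr rfl (congrArg g (Subtype.ext hy)) _⟩
      exact (congrArg (· ∈ V) hy).mpr y.2
    · rintro ⟨x, rfl⟩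
      exact ⟨_, ⟨_, rfl⟩, _, ⟨_, rfl⟩, hc x, rfl⟩

theorem isClopenSection_setPref {S T : Set C.Arr} (hS : C.IsClopenSection S)
    (hT : C.IsClopenSection T) : C.IsClopenSection (C.setPref S T) := by
  have h1 := isClopenSection_iff.1 hS
  have h2 := isClopenSection_iff.1 (isClopenSection_setComp (isClopenSection_setAntidom hS) hT)
  refine isClopenSection_iff.2 ⟨h1.1.union h2.1, ?_, ?_⟩
  · intro f hf g hg h
    replace hf := mem_setPref.1 hf
    replace hg := mem_setPref.1 hg
    rcases hf with hf | ⟨hf, hf'⟩ <;> rcases hg with hg | ⟨hg, hg'⟩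
    · exact h1.2.1 hf hg h
    · exact absurd ⟨f, hf, h⟩ hg
    · exact absurd ⟨g, hg, h.symm⟩ hf
    · exact (isClopenSection_iff.1 hT).2.1 hf' hg' h
  · rw [setPref, Set.image_union]
    exact h1.2.2.union h2.2.2

/-- The clopen sections form a basis. -/
theorem exists_isClopenSection {U : Set C.Arr} (hU : IsOpen U) {f : C.Arr} (hf : f ∈ U) :
    ∃ S, C.IsClopenSection S ∧ f ∈ S ∧ S ⊆ U := by
  obtain ⟨W, hW, hemb⟩ := isLocalHomeomorph_iff_isOpenEmbedding_restrict.1 C.localHomeo_src f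
  obtain ⟨W', hWW', hW', hfW'⟩ := mem_nhds_iff.1 hW
  have hO : IsOpen (U ∩ W') := hU.inter hW'
  -- The space of objects has a basis of clopen sets, so the open set of sources shrinks to a clopen
  -- one.
  obtain ⟨V, hV, hfV, hVs⟩ := compact_exists_isClopen_in_isOpen
    (C.localHomeo_src.isOpenMap _ hO) ⟨f, ⟨hf, hfW'⟩, rfl⟩
  refine ⟨(U ∩ W') ∩ C.src ⁻¹' V, isClopenSection_iff.2
    ⟨hO.inter (hV.isOpen.preimage C.continuous_src), ?_, ?_⟩, ⟨⟨hf, hfW'⟩, hfV⟩,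
    fun g hg => hg.1.1⟩
  · exact (Set.injOn_iff_injective.2 hemb.injective).mono fun g hg => hWW' hg.1.2
  · rwa [Set.image_inter_preimage, Set.inter_eq_right.2 hVs]

/-- The clopen sections of the source map. -/
def Sections (C : StoneEtaleCat.{u}) : Type u := {S : Set C.Arr // C.IsClopenSection S}

instance : FunSig C.Sections where
  comp S T := ⟨C.setComp S.1 T.1, isClopenSection_setComp S.2 T.2⟩
  antidom S := ⟨C.setAntidom S.1, isClopenSection_setAntidom S.2⟩
  rng S := ⟨C.setRng S.1, isClopenSection_setRng S.2⟩
  pref S T := ⟨C.setPref S.1 T.1, isClopenSection_setPref S.2 T.2⟩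

instance : Nonempty C.Sections := ⟨⟨_, isClopenSection_one_image isClopen_empty⟩⟩

theorem Sections.src_injOn (S : C.Sections) : Set.InjOn C.src S.1 :=
  (isClopenSection_iff.1 S.2).2.1

/-- The points of the representation of the algebra of sections: sets of arrows with a
common source. -/
def Costar (C : StoneEtaleCat.{u}) : Type u :=
  {p : C.Obj × Set C.Arr // ∀ f ∈ p.2, C.src f = p.1}

/-! ### The representation of sections on costars. -/

namespace Costar

/-- The action of an arrow on sets of arrows, by division on the left. -/
def act (a : C.Arr) (p : C.Costar) : C.Costar :=
  ⟨(C.tgt a, {g | ∃ h : C.tgt a = C.src g, C.comp a g h ∈ p.1.2}), fun _ ⟨h, _⟩ => h.symm⟩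

theorem ext_iff {p q : C.Costar} :
    p = q ↔ p.1.1 = q.1.1 ∧ ∀ f, f ∈ p.1.2 ↔ f ∈ q.1.2 := by
  rw [← Set.ext_iff, ← Prod.ext_iff]
  exact Subtype.ext_iff

theorem act_one (p : C.Costar) : act (C.one p.1.1) p = p := by
  refine ext_iff.2 ⟨C.tgt_one _, fun f => ⟨?_, fun hf => ?_⟩⟩
  · rintro ⟨h, h'⟩
    rwa [one_comp'] at h'
  · refine ⟨(C.tgt_one _).trans (p.2 f hf).symm, ?_⟩
    rwa [one_comp']

theorem act_comp (a b : C.Arr) (h : C.tgt a = C.src b) (p : C.Costar) :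
    act (C.comp a b h) p = act b (act a p) := by
  refine ext_iff.2 ⟨C.tgt_comp a b h, fun f => ⟨?_, ?_⟩⟩
  · rintro ⟨h1, h2⟩
    have h3 : C.tgt b = C.src f := (C.tgt_comp a b h).symm.trans h1
    refine ⟨h3, h.trans (C.src_comp b f h3).symm, ?_⟩
    rwa [← C.assoc]
  · rintro ⟨h1, h2, h3⟩
    refine ⟨(C.tgt_comp a b h).trans h1, ?_⟩
    rwa [C.assoc]

/-- The preimage of `q` is its left translate by `a`. Dividing it by `a` returns no more than `q`
because `a` is an epimorphism. -/
theorem exists_act_eq {a : C.Arr} {q : C.Costar} (h : C.tgt a = q.1.1) :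
    ∃ p : C.Costar, p.1.1 = C.src a ∧ act a p = q := by
  refine ⟨⟨(C.src a, {k | ∃ g ∈ q.1.2, ∃ h : C.tgt a = C.src g, k = C.comp a g h}), ?_⟩, rfl, ?_⟩
  · rintro _ ⟨g, -, h, rfl⟩
    exact C.src_comp _ _ _
  · refine ext_iff.2 ⟨h, fun f => ⟨?_, fun hf => ?_⟩⟩
    · rintro ⟨h1, g, hg, h2, h3⟩
      rwa [C.epi a f g h1 h2 h3]
    · have h1 : C.tgt a = C.src f := h.trans (q.2 f hf).symm
      exact ⟨h1, f, hf, h1, rfl⟩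

/-- Tested on the costar `{a}`: its image under `a` contains the identity at the target, so its
image under `b` does too, which says `b = a`. -/
theorem eq_of_act_eq {a b : C.Arr} (h : ∀ p : C.Costar, p.1.1 = C.src a → act a p = act b p) :
    a = b := by
  obtain ⟨-, h1⟩ := ext_iff.1 (h ⟨(C.src a, {a}), by rintro _ rfl; rfl⟩ rfl)
  obtain ⟨h2, h3⟩ := (h1 (C.one (C.tgt a))).1 ⟨(C.src_one _).symm, C.comp_one a⟩
  rw [comp_one'] at h3
  exact h3.symm

end Costar

open Costar

namespace Sections

variable {S T : C.Sections} {p q : C.Costar}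

/-- The section `S` sends the costar `p` to `q`. -/
def Sends (S : C.Sections) (p q : C.Costar) : Prop :=
  ∃ a ∈ S.1, C.src a = p.1.1 ∧ q = act a p

theorem exists_sends : (∃ q, S.Sends p q) ↔ p.1.1 ∈ C.src '' S.1 :=
  ⟨fun ⟨_, a, ha, hs, _⟩ => ⟨a, ha, hs⟩, fun ⟨a, ha, hs⟩ => ⟨_, a, ha, hs, rfl⟩⟩

theorem sends_one_image {V : Set C.Obj} (hV : C.IsClopenSection (C.one '' V)) :
    Sends ⟨_, hV⟩ p q ↔ p = q ∧ p.1.1 ∈ V := by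
  constructor
  · rintro ⟨_, ⟨x, hx, rfl⟩, hs, rfl⟩
    rw [C.src_one] at hs
    subst hs
    exact ⟨(act_one p).symm, hx⟩
  · rintro ⟨rfl, h⟩
    exact ⟨_, ⟨_, h, rfl⟩, C.src_one _, (act_one p).symm⟩

theorem sends_comp : (FunSig.comp S T).Sends p q ↔ ∃ r, S.Sends p r ∧ T.Sends r q := by
  constructor
  · rintro ⟨_, ⟨a, ha, b, hb, h, rfl⟩, hs, rfl⟩
    rw [C.src_comp] at hs
    exact ⟨_, ⟨a, ha, hs, rfl⟩, b, hb, h.symm, act_comp a b h p⟩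
  · rintro ⟨_, ⟨a, ha, hs, rfl⟩, b, hb, hs', rfl⟩
    exact ⟨_, ⟨a, ha, b, hb, hs'.symm, rfl⟩, (C.src_comp _ _ _).trans hs,
      (act_comp a b hs'.symm p).symm⟩

theorem sends_antidom : (FunSig.antidom S).Sends p q ↔ p = q ∧ ¬ ∃ r, S.Sends p r := by
  rw [exists_sends]
  exact sends_one_image _

theorem sends_rng : (FunSig.rng S).Sends p q ↔ p = q ∧ ∃ r, S.Sends r p := by
  refine (sends_one_image _).trans (and_congr_right fun _ => ?_)
  constructor
  · rintro ⟨a, ha, h⟩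
    obtain ⟨r, hr, hr'⟩ := exists_act_eq h
    exact ⟨r, a, ha, hr.symm, hr'.symm⟩
  · rintro ⟨r, a, ha, -, rfl⟩
    exact ⟨a, ha, rfl⟩

theorem sends_pref :
    (FunSig.pref S T).Sends p q ↔ S.Sends p q ∨ (¬ ∃ r, S.Sends p r) ∧ T.Sends p q := by
  rw [exists_sends]
  constructor
  · rintro ⟨a, ha, hs, hq⟩
    rcases mem_setPref.1 ha with ha | ⟨ha, ha'⟩
    · exact Or.inl ⟨a, ha, hs, hq⟩
    · exact Or.inr ⟨hs ▸ ha, a, ha', hs, hq⟩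
  · rintro (⟨a, ha, hs, hq⟩ | ⟨h, a, ha, hs, hq⟩)
    · exact ⟨a, mem_setPref.2 (Or.inl ha), hs, hq⟩
    · exact ⟨a, mem_setPref.2 (Or.inr ⟨hs ▸ h, ha⟩), hs, hq⟩

theorem subset_of_sends (h : ∀ p q, S.Sends p q → T.Sends p q) : S.1 ⊆ T.1 := by
  intro a ha
  have hT : ∀ p : C.Costar, p.1.1 = C.src a → ∃ b ∈ T.1, C.src b = C.src a ∧
      act a p = act b p := by
    intro p hp
    obtain ⟨b, hb, hs, h2⟩ := h p _ ⟨a, ha, hp.symm, rfl⟩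
    exact ⟨b, hb, hs.trans hp, h2⟩
  -- The empty costar selects one `b`. The arrows of `T` found for the other costars have the same
  -- source, hence coincide with it.
  obtain ⟨b, hb, hs, -⟩ := hT ⟨(C.src a, ∅), fun _ h => h.elim⟩ rfl
  rw [eq_of_act_eq (a := a) (b := b) fun p hp => ?_]
  · exact hb
  · obtain ⟨b', hb', hs', h'⟩ := hT p hp
    rwa [T.src_injOn hb hb' (hs.trans hs'.symm)]

/-- The partial function on costars given by a section. -/
def toPartialFn (S : C.Sections) : PartialFn C.Costar where
  graph := {p | S.Sends p.1 p.2}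
  functional := by
    intro p q r ⟨a, ha, hs, hq⟩ ⟨b, hb, hs', hr⟩
    rw [S.src_injOn ha hb (hs.trans hs'.symm)] at hq
    exact hq.trans hr.symm

end Sections

open Sections

theorem representable_sections (C : StoneEtaleCat.{u}) : Representable C.Sections := by
  refine ⟨C.Costar, ⟨toPartialFn, fun _ _ => PartialFn.ext (Set.ext fun _ => sends_comp),
    fun _ => PartialFn.ext (Set.ext fun _ => sends_antidom),
    fun _ => PartialFn.ext (Set.ext fun _ => sends_rng),
    fun _ _ => PartialFn.ext (Set.ext fun _ => sends_pref)⟩, fun S T h => ?_⟩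
  have h' : ∀ p q, S.Sends p q ↔ T.Sends p q := fun p q =>
    Set.ext_iff.1 (congrArg PartialFn.graph h) (p, q)
  exact Subtype.ext ((subset_of_sends fun p q => (h' p q).1).antisymm
    (subset_of_sends fun p q => (h' p q).2))

/-- The algebra of clopen sections. -/
def sectionAlg (C : StoneEtaleCat.{u}) : RepAlg.{u} := ⟨C.Sections, C.representable_sections⟩

end StoneEtaleCat

open StoneEtaleCat

theorem isSectionAlgebra_sectionAlg (C : StoneEtaleCat.{u}) :
    IsSectionAlgebra C.toTopologicalCategory C.sectionAlg (Equiv.refl _) where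
  comp_eq _ _ := rfl
  antidom_eq _ := rfl
  rng_eq _ := rfl
  pref_eq _ _ := rfl

/-! ## Inverse images of sections -/

namespace StarCoherentFunctor

variable {C D : StoneEtaleCat.{u}} (F : C ⟶ D)

/-- The inverse image of a set of arrows. -/
def preimage (S : Set D.Arr) : Set C.Arr := {f | ∃ g ∈ S, F.rel f g}

variable {F}

theorem exists_rel {x : C.Obj} {g : D.Arr} (h : D.src g = F.obj x) :
    ∃ f, C.src f = x ∧ F.rel f g := F.coherent.starSurjective x g h

theorem eq_of_rel {f₁ f₂ : C.Arr} {g : D.Arr} (h : C.src f₁ = C.src f₂) (h₁ : F.rel f₁ g)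
    (h₂ : F.rel f₂ g) : f₁ = f₂ := F.coherent.starInjective f₁ f₂ g h h₁ h₂

theorem src_image_preimage (S : Set D.Arr) :
    C.src '' preimage F S = F.obj ⁻¹' (D.src '' S) := by
  ext x
  constructor
  · rintro ⟨f, ⟨g, hg, h⟩, rfl⟩
    exact ⟨g, hg, F.rel_src _ _ h⟩
  · rintro ⟨g, hg, h⟩
    obtain ⟨f, hf, hfg⟩ := exists_rel h
    exact ⟨f, ⟨g, hg, hfg⟩, hf⟩

/-- Openness of `S` is needed because the star condition at targets only concerns open sets. -/
theorem tgt_image_preimage {S : Set D.Arr} (hS : IsOpen S) :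
    C.tgt '' preimage F S = F.obj ⁻¹' (D.tgt '' S) := by
  ext y
  constructor
  · rintro ⟨f, ⟨g, hg, h⟩, rfl⟩
    exact ⟨g, hg, F.rel_tgt _ _ h⟩
  · rintro ⟨g, hg, h⟩
    obtain ⟨f, hf, hfg⟩ := F.coherent.coPseudoStarSurjective y S hS ⟨g, hg, h⟩
    exact ⟨f, hfg, hf⟩

theorem isClopenSection_preimage {S : Set D.Arr} (hS : D.IsClopenSection S) :
    C.IsClopenSection (preimage F S) := by
  obtain ⟨h1, h2, h3⟩ := isClopenSection_iff.1 hS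
  refine isClopenSection_iff.2 ⟨F.continuous_rel S h1, ?_, ?_⟩
  · rintro f₁ ⟨g₁, hg₁, h₁⟩ f₂ ⟨g₂, hg₂, h₂⟩ h
    have hg : g₁ = g₂ := h2 hg₁ hg₂ (by rw [F.rel_src _ _ h₁, F.rel_src _ _ h₂, h])
    exact eq_of_rel h h₁ (hg ▸ h₂)
  · rw [src_image_preimage]
    exact h3.preimage F.continuous_obj

theorem preimage_one_image (V : Set D.Obj) :
    preimage F (D.one '' V) = C.one '' (F.obj ⁻¹' V) := by
  ext f
  constructor
  · rintro ⟨_, ⟨y, hy, rfl⟩, h⟩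
    have hs := F.rel_src _ _ h
    rw [D.src_one] at hs
    subst hs
    exact ⟨_, hy, eq_of_rel (C.src_one _) (F.rel_one _) h⟩
  · rintro ⟨x, hx, rfl⟩
    exact ⟨_, ⟨_, hx, rfl⟩, F.rel_one x⟩

/-- Star surjectivity lifts the two factors successively from the source of `f`; star injectivity
identifies `f` with the composite of the lifts. -/
theorem preimage_setComp (S T : Set D.Arr) :
    preimage F (D.setComp S T) = C.setComp (preimage F S) (preimage F T) := by
  ext f
  constructor
  · rintro ⟨_, ⟨g₁, hg₁, g₂, hg₂, h, rfl⟩, hf⟩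
    have hs := F.rel_src _ _ hf
    rw [D.src_comp] at hs
    obtain ⟨f₁, hs₁, h₁⟩ := exists_rel hs
    obtain ⟨f₂, hs₂, h₂⟩ := exists_rel (h.symm.trans (F.rel_tgt _ _ h₁))
    refine ⟨f₁, ⟨g₁, hg₁, h₁⟩, f₂, ⟨g₂, hg₂, h₂⟩, hs₂.symm, eq_of_rel ?_ hf
      (F.rel_comp _ _ _ _ hs₂.symm h h₁ h₂)⟩
    rw [C.src_comp, hs₁]
  · rintro ⟨f₁, ⟨g₁, hg₁, h₁⟩, f₂, ⟨g₂, hg₂, h₂⟩, h, rfl⟩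
    have h' : D.tgt g₁ = D.src g₂ := by rw [F.rel_tgt _ _ h₁, F.rel_src _ _ h₂, h]
    exact ⟨_, ⟨g₁, hg₁, g₂, hg₂, h', rfl⟩, F.rel_comp _ _ _ _ h h' h₁ h₂⟩

theorem preimage_setAntidom (S : Set D.Arr) :
    preimage F (D.setAntidom S) = C.setAntidom (preimage F S) := by
  rw [setAntidom, preimage_one_image, setAntidom, src_image_preimage, Set.preimage_compl]

theorem preimage_setRng {S : Set D.Arr} (hS : IsOpen S) :
    preimage F (D.setRng S) = C.setRng (preimage F S) := by
  rw [setRng, preimage_one_image, setRng, tgt_image_preimage hS]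

theorem preimage_setPref (S T : Set D.Arr) :
    preimage F (D.setPref S T) = C.setPref (preimage F S) (preimage F T) := by
  rw [setPref, setPref, ← preimage_setAntidom, ← preimage_setComp]
  ext f
  constructor
  · rintro ⟨g, hg | hg, h⟩
    exacts [Or.inl ⟨g, hg, h⟩, Or.inr ⟨g, hg, h⟩]
  · rintro (⟨g, hg, h⟩ | ⟨g, hg, h⟩)
    exacts [⟨g, Or.inl hg, h⟩, ⟨g, Or.inr hg, h⟩]

end StarCoherentFunctor

open StarCoherentFunctor

/-- The homomorphism of inverse images under a star-coherent functor. -/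
def sectionMap {C D : StoneEtaleCat.{u}} (F : C ⟶ D) : D.sectionAlg ⟶ C.sectionAlg where
  toFun S := ⟨preimage F S.1, isClopenSection_preimage S.2⟩
  map_comp _ _ := Subtype.ext (preimage_setComp _ _)
  map_antidom _ := Subtype.ext (preimage_setAntidom _)
  map_rng S := Subtype.ext (preimage_setRng (isClopenSection_iff.1 S.2).1)
  map_pref _ _ := Subtype.ext (preimage_setPref _ _)

/-- The functor of sections over clopens. -/
def sectionFunctor : StoneEtaleCat.{u} ⥤ RepAlg.{u}ᵒᵖ where
  obj C := op C.sectionAlg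
  map F := (sectionMap F).op
  map_id C := by
    refine congrArg Quiver.Hom.op (FunHom.ext (funext fun S => Subtype.ext (Set.ext fun f => ?_)))
    exact ⟨fun ⟨g, hg, h⟩ => by rwa [show f = g from h], fun hf => ⟨f, hf, rfl⟩⟩
  map_comp F G := by
    refine congrArg Quiver.Hom.op (FunHom.ext (funext fun S => Subtype.ext (Set.ext fun f => ?_)))
    exact ⟨fun ⟨k, hk, g, h, h'⟩ => ⟨g, ⟨k, hk, h'⟩, h⟩, fun ⟨g, ⟨k, hk, h'⟩, h⟩ => ⟨k, hk, g, h, h'⟩⟩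

theorem isSectionFunctor_sectionFunctor : IsSectionFunctor sectionFunctor.{u} :=
  ⟨fun _ => Equiv.refl _, isSectionAlgebra_sectionAlg, fun _ _ _ _ => rfl⟩

/-! ## The unit -/

/-- Bijective homomorphisms are isomorphisms. -/
noncomputable def isoOfBijective {A B : RepAlg.{u}} (h : A ⟶ B)
    (hh : Function.Bijective h.toFun) : A ≅ B where
  hom := h
  inv :=
    { toFun := (Equiv.ofBijective _ hh).symm
      map_comp := fun a b => hh.1 (by
        simp only [h.map_comp, Equiv.ofBijective_apply_symm_apply])
      map_antidom := fun a => hh.1 (by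
        simp only [h.map_antidom, Equiv.ofBijective_apply_symm_apply])
      map_rng := fun a => hh.1 (by
        simp only [h.map_rng, Equiv.ofBijective_apply_symm_apply])
      map_pref := fun a b => hh.1 (by
        simp only [h.map_pref, Equiv.ofBijective_apply_symm_apply]) }
  hom_inv_id := FunHom.ext (funext fun a => Equiv.ofBijective_symm_apply_apply _ hh a)
  inv_hom_id := FunHom.ext (funext fun a => Equiv.ofBijective_apply_symm_apply _ hh a)

section Unit

variable {A : RepAlg.{u}}

/-- The set of prime filters containing `a`. -/
def basicSet (a : A) : Set (primeFilterCat A).Arr := {P : PrimeFilter A | a ∈ P.1}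

theorem src_image_basicSet (a : A) :
    (primeFilterCat A).src '' basicSet a = {μ : DomUltrafilter A | dom a ∈ μ.1} :=
  PrimeFilter.src_image a

theorem tgt_image_basicSet (a : A) :
    (primeFilterCat A).tgt '' basicSet a = {μ : DomUltrafilter A | rng a ∈ μ.1} :=
  PrimeFilter.tgt_image a

theorem isClopenSection_basicSet (a : A) : (primeFilterCat A).IsClopenSection (basicSet a) := by
  refine isClopenSection_iff.2 ⟨PrimeFilter.isOpen_mem a, ?_, ?_⟩
  · exact fun P hP Q hQ h => PrimeFilter.ext_of_mem h hP hQ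
  · rw [src_image_basicSet]
    exact DomUltrafilter.isClopen_mem (dom_mem a)

/-- A prime filter containing `a ⬝ b` factors as the germ of `a` at its source followed by the germ
of `b` at the target reached. -/
theorem basicSet_comp (a b : A) :
    basicSet (a ⬝ b) = (primeFilterCat A).setComp (basicSet a) (basicSet b) := by
  apply Set.Subset.antisymm
  · intro (P : PrimeFilter A) (hP : a ⬝ b ∈ P.1)
    have hd := PrimeFilter.dom_mem_src hP
    have ha : dom a ∈ P.src.1 := P.src.2.up hd (dom_mem a) (dom_comp_le a b)
    let Q := PrimeFilter.germ P.src a ha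
    have hQ : a ∈ Q.1 := PrimeFilter.mem_germ _ _ ha
    have hQP : Q.src = P.src := PrimeFilter.src_germ _ _ ha
    have hb : dom b ∈ Q.tgt.1 := Q.tgt.2.up
      (PrimeFilter.rng_mem_tgt (Q.2.comp_mem (hQP.symm ▸ hd : _ ∈ Q.src.1) hQ)) (dom_mem b)
      (rng_dom_comp_comp_le a b)
    let R := PrimeFilter.germ Q.tgt b hb
    have hR : b ∈ R.1 := PrimeFilter.mem_germ _ _ hb
    have h : Q.tgt = R.src := (PrimeFilter.src_germ _ _ hb).symm
    exact ⟨Q, hQ, R, hR, h, PrimeFilter.ext_of_mem (hQP.symm.trans (PrimeFilter.src_comp _ _ h).symm)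
      hP (PrimeFilter.comp_mem_comp h hQ hR)⟩
  · rintro _ ⟨P, hP, Q, hQ, h, rfl⟩
    exact PrimeFilter.comp_mem_comp h hP hQ

/-- Only identities contain domain elements, which matches antidomain and range with sets of
identity arrows. -/
theorem PrimeFilter.mem_iff_of_mem_domElts {P : PrimeFilter A} {α : A} (hα : α ∈ domElts A) :
    α ∈ P.1 ↔ P = one P.src ∧ α ∈ P.src.1 := by
  constructor
  · intro h
    have h' : α ∈ P.src.1 := dom_eq hα ▸ dom_mem_src h
    exact ⟨ext_of_mem (src_one _).symm h (mem_one h'), h'⟩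
  · rintro ⟨h, h'⟩
    rw [h]
    exact mem_one h'

theorem mem_src_image_basicSet {a : A} {μ : DomUltrafilter A} :
    μ ∈ (primeFilterCat A).src '' basicSet a ↔ dom a ∈ μ.1 :=
  Set.ext_iff.1 (src_image_basicSet a) μ

theorem basicSet_antidom (a : A) :
    basicSet (antidom a) = (primeFilterCat A).setAntidom (basicSet a) := by
  refine Set.ext fun P => (PrimeFilter.mem_iff_of_mem_domElts (antidom_mem a)).trans
    (Iff.trans (and_congr_right fun _ => ?_) mem_setAntidom.symm)
  rw [← antidom_dom]
  exact ((PrimeFilter.src P).2.antidom_mem_iff (dom_mem a)).trans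
    (not_congr mem_src_image_basicSet.symm)

theorem basicSet_rng (a : A) :
    basicSet (rng a) = (primeFilterCat A).setRng (basicSet a) :=
  Set.ext fun P => (PrimeFilter.mem_iff_of_mem_domElts (rng_mem a)).trans
    (Iff.trans (and_congr_right fun _ =>
      (Set.ext_iff.1 (tgt_image_basicSet a) (PrimeFilter.src P)).symm)
      mem_setRng.symm)

theorem basicSet_pref (a b : A) :
    basicSet (pref a b) = (primeFilterCat A).setPref (basicSet a) (basicSet b) := by
  refine Set.ext fun (P : PrimeFilter A) => Iff.trans ?_ mem_setPref.symm
  change pref a b ∈ P.1 ↔ a ∈ P.1 ∨ P.src ∉ _ ∧ b ∈ P.1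
  rw [mem_src_image_basicSet]
  constructor
  · intro h
    by_cases ha : dom a ∈ P.src.1
    · exact Or.inl (dom_pref_comp a b ▸ P.2.comp_mem ha h)
    · exact (P.2.prime a b h).imp_right fun hb => ⟨ha, hb⟩
  · rintro (h | ⟨h, hb⟩)
    · exact P.2.up h (le_pref_left a b)
    · rw [← P.src.2.antidom_mem_iff (dom_mem a), antidom_dom] at h
      exact P.2.up (P.2.comp_mem h hb) (antidom_comp_le_pref a b)

variable (A) in
/-- The canonical homomorphism to the algebra of sections of the category of prime filters. -/
def unitHom : A ⟶ (primeFilterCat A).sectionAlg where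
  toFun a := ⟨basicSet a, isClopenSection_basicSet a⟩
  map_comp a b := Subtype.ext (basicSet_comp a b)
  map_antidom a := Subtype.ext (basicSet_antidom a)
  map_rng a := Subtype.ext (basicSet_rng a)
  map_pref a b := Subtype.ext (basicSet_pref a b)

/-- At a point `x` where `a` is defined, the germ of `a` at the principal ultrafilter of `x`
contains `b`. Some restriction of `a` still defined at `x` thus lies below `b`. -/
theorem le_of_basicSet_subset {a b : A} (h : basicSet a ⊆ basicSet b) : le a b := by
  refine le_iff.2 fun x y hxy => ?_
  let μ : DomUltrafilter A := ⟨_, isDomUltrafilter_of_ultrafilter (pure x)⟩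
  have ha : dom a ∈ μ.1 := ⟨dom_mem a, maps_dom.2 ⟨rfl, y, hxy⟩⟩
  obtain ⟨α, ⟨-, hα⟩, hle⟩ := @h (PrimeFilter.germ μ a ha) (PrimeFilter.mem_germ μ a ha)
  exact le_iff.1 hle _ _ (maps_comp.2 ⟨x, hα, hxy⟩)

/-- Compactness of the set of sources covers it by those of finitely many basic sets inside `S`.
Primeness keeps their preferential union inside `S`, and injectivity of the source map on `S` then
forces equality. -/
theorem exists_basicSet_eq {S : Set (primeFilterCat A).Arr}
    (hS : (primeFilterCat A).IsClopenSection S) : ∃ a : A, basicSet a = S := by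
  obtain ⟨hopen, hinj, hcl⟩ := isClopenSection_iff.1 hS
  have key : ∃ a : A, basicSet a ⊆ S ∧
      ∀ μ ∈ (primeFilterCat A).src '' S, μ ∈ (primeFilterCat A).src '' basicSet a := by
    refine hcl.isClosed.isCompact.induction_on (p := fun V => ∃ a : A, basicSet a ⊆ S ∧
      ∀ μ ∈ V, μ ∈ (primeFilterCat A).src '' basicSet a) ?_ ?_ ?_ ?_
    · exact ⟨zero A, fun P hP => absurd hP P.2.zero_notMem, fun _ h => h.elim⟩
    · exact fun V W hVW ⟨a, h1, h2⟩ => ⟨a, h1, fun μ hμ => h2 μ (hVW hμ)⟩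
    · rintro V W ⟨a, h1, h2⟩ ⟨b, h3, h4⟩
      refine ⟨pref a b, ?_, ?_⟩
      · exact fun P hP => (P.2.prime a b hP).elim (fun h => h1 h) (fun h => h3 h)
      · intro μ hμ
        by_cases ha : μ ∈ (primeFilterCat A).src '' basicSet a
        · obtain ⟨P, hP, rfl⟩ := ha
          exact ⟨P, basicSet_pref a b ▸ mem_setPref.2 (Or.inl hP), rfl⟩
        · obtain ⟨P, hP, rfl⟩ := h4 μ (hμ.resolve_left fun h => ha (h2 μ h))
          exact ⟨P, basicSet_pref a b ▸ mem_setPref.2 (Or.inr ⟨ha, hP⟩), rfl⟩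
    · rintro _ ⟨P, hP, rfl⟩
      obtain ⟨_, ⟨a, rfl⟩, ha, hs⟩ :=
        PrimeFilter.isTopologicalBasis.exists_subset_of_mem_open hP hopen
      refine ⟨_, mem_nhdsWithin_of_mem_nhds (((primeFilterCat A).localHomeo_src.isOpenMap _
        (PrimeFilter.isOpen_mem a)).mem_nhds ⟨P, ha, rfl⟩), a, hs, fun μ hμ => hμ⟩
  obtain ⟨a, h1, h2⟩ := key
  refine ⟨a, h1.antisymm fun P hP => ?_⟩
  obtain ⟨Q, hQ, h⟩ := h2 _ ⟨P, hP, rfl⟩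
  rwa [← hinj (h1 hQ) hP h]

theorem unitHom_bijective : Function.Bijective (unitHom A).toFun := by
  constructor
  · intro a b h
    have h' : basicSet a = basicSet b := congrArg Subtype.val h
    exact le.antisymm (le_of_basicSet_subset h'.subset) (le_of_basicSet_subset h'.superset)
  · rintro ⟨S, hS⟩
    obtain ⟨a, ha⟩ := exists_basicSet_eq hS
    exact ⟨a, Subtype.ext ha⟩

end Unit

/-- The unit of the equivalence. -/
noncomputable def unitNatIso : 𝟭 RepAlg.{u}ᵒᵖ ≅ primeFilterFunctor ⋙ sectionFunctor :=
  -- Passing to the opposite category reverses `unitHom`, so the isomorphism is assembled towards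
  -- the identity and then inverted.
  (NatIso.ofComponents (F := primeFilterFunctor ⋙ sectionFunctor) (G := 𝟭 _)
    (fun A => (isoOfBijective (unitHom A.unop) unitHom_bijective).op) (fun {A B} h => by
      refine congrArg Quiver.Hom.op (FunHom.ext (funext fun b => Subtype.ext (Set.ext fun P => ?_)))
      exact PrimeFilter.exists_subset_preimage_iff h.unop)).symm

/-! ## The counit -/

/-- An isomorphism of topological categories is star coherent. -/
def StarCoherentFunctor.ofHomeomorph {C D : StoneEtaleCat.{u}} (o : C.Obj ≃ₜ D.Obj)
    (m : C.Arr ≃ₜ D.Arr) (hs : ∀ f, D.src (m f) = o (C.src f))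
    (ht : ∀ f, D.tgt (m f) = o (C.tgt f)) (h1 : ∀ x, m (C.one x) = D.one (o x))
    (hc : ∀ f g h h', m (C.comp f g h) = D.comp (m f) (m g) h') : C ⟶ D where
  obj := o
  rel f g := m f = g
  rel_src := by
    rintro f _ rfl
    exact hs f
  rel_tgt := by
    rintro f _ rfl
    exact ht f
  rel_one := h1
  rel_comp := by
    rintro f₁ f₂ _ _ h h' rfl rfl
    exact hc _ _ _ _
  continuous_obj := o.continuous
  continuous_rel U hU := by
    convert hU.preimage m.continuous using 1
    ext f
    simp
  coherent :=
    { starInjective := by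
        rintro f₁ f₂ g - rfl h
        exact (m.injective h).symm
      starSurjective := fun x g h => ⟨m.symm g, o.injective (by
        rw [← hs, m.apply_symm_apply, h]), m.apply_symm_apply g⟩
      coPseudoStarSurjective := by
        rintro y U - ⟨g, hg, h⟩
        exact ⟨m.symm g, o.injective (by rw [← ht, m.apply_symm_apply, h]), g, hg,
          m.apply_symm_apply g⟩ }

/-- Isomorphic topological categories are isomorphic in the category of star-coherent functors. -/
def StoneEtaleCat.isoOfHomeomorph {C D : StoneEtaleCat.{u}} (o : C.Obj ≃ₜ D.Obj)
    (m : C.Arr ≃ₜ D.Arr) (hs : ∀ f, D.src (m f) = o (C.src f))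
    (ht : ∀ f, D.tgt (m f) = o (C.tgt f)) (h1 : ∀ x, m (C.one x) = D.one (o x))
    (hc : ∀ f g h h', m (C.comp f g h) = D.comp (m f) (m g) h') : C ≅ D where
  hom := .ofHomeomorph o m hs ht h1 hc
  inv := .ofHomeomorph o.symm m.symm
    (fun g => o.injective (by rw [← hs, m.apply_symm_apply, o.apply_symm_apply]))
    (fun g => o.injective (by rw [← ht, m.apply_symm_apply, o.apply_symm_apply]))
    (fun y => m.injective (by rw [h1, m.apply_symm_apply, o.apply_symm_apply]))
    (fun f g h h' => m.injective (by
      have h'' : D.tgt (m (m.symm f)) = D.src (m (m.symm g)) := by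
        rw [m.apply_symm_apply, m.apply_symm_apply, h]
      rw [hc _ _ h' h'', m.apply_symm_apply]
      exact comp_congr (m.apply_symm_apply f).symm (m.apply_symm_apply g).symm h))
  hom_inv_id := by
    apply StarCoherentFunctor.ext
    · exact funext o.symm_apply_apply
    · funext f g
      refine propext ⟨?_, ?_⟩
      · rintro ⟨_, rfl, rfl⟩
        exact (m.symm_apply_apply f).symm
      · rintro rfl
        exact ⟨_, rfl, m.symm_apply_apply _⟩
  inv_hom_id := by
    apply StarCoherentFunctor.ext
    · exact funext o.apply_symm_apply
    · funext f g
      refine propext ⟨?_, ?_⟩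
      · rintro ⟨_, rfl, rfl⟩
        exact (m.apply_symm_apply f).symm
      · rintro rfl
        exact ⟨_, rfl, m.apply_symm_apply _⟩

section Counit

variable {C D : StoneEtaleCat.{u}}

/-! ### Order and domain elements in the algebra of sections. -/

namespace StoneEtaleCat.Sections

theorem coe_dom (S : C.sectionAlg) : (dom S).1 = C.one '' (C.src '' S.1) :=
  setAntidom_setAntidom S.1

theorem le_iff {S T : C.sectionAlg} : le S T ↔ S.1 ⊆ T.1 := by
  have h : (dom S ⬝ T).1 = {f | f ∈ T.1 ∧ C.src f ∈ C.src '' S.1} := by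
    rw [← setComp_one_image, ← coe_dom]
    rfl
  refine ⟨fun hle => ?_, fun hs => Subtype.ext (h.trans ?_)⟩
  · rw [← show dom S ⬝ T = S from hle, h]
    exact fun f hf => hf.1
  · refine Set.Subset.antisymm ?_ fun f hf => ⟨hs hf, f, hf, rfl⟩
    rintro f ⟨hf, g, hg, hfg⟩
    rwa [← Sections.src_injOn T (hs hg) hf hfg]

theorem exists_of_mem_domElts {α : C.sectionAlg} (h : α ∈ domElts C.sectionAlg) :
    ∃ V, IsClopen V ∧ α.1 = C.one '' V := by
  rw [← dom_eq h, coe_dom]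
  exact ⟨_, (isClopenSection_iff.1 α.2).2.2, rfl⟩

/-- The set of identities on a clopen set of objects. -/
def idSec (V : Set C.Obj) (hV : IsClopen V) : C.sectionAlg :=
  ⟨C.one '' V, isClopenSection_one_image hV⟩

theorem idSec_mem_domElts (V : Set C.Obj) (hV : IsClopen V) :
    idSec V hV ∈ domElts C.sectionAlg := by
  rw [← show dom (idSec V hV) = idSec V hV from Subtype.ext ?_]
  · exact dom_mem _
  · rw [coe_dom]
    exact congrArg _ (src_image_one V)

theorem one_mem_one_image {V : Set C.Obj} {x : C.Obj} : C.one x ∈ C.one '' V ↔ x ∈ V :=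
  Function.Injective.mem_set_image (Function.LeftInverse.injective C.src_one)

theorem coe_comp (S T : C.sectionAlg) : (S ⬝ T).1 = C.setComp S.1 T.1 := rfl

theorem coe_zero : (zero C.sectionAlg).1 = ∅ :=
  Set.subset_empty_iff.1 (le_iff.1 (zero_le (idSec ∅ isClopen_empty)) |>.trans
    (Set.image_empty _).subset)

end StoneEtaleCat.Sections

open StoneEtaleCat.Sections

/-- The ultrafilter of clopen neighbourhoods of `x`. -/
theorem isDomUltrafilter_one_mem (x : C.Obj) :
    IsDomUltrafilter {α : C.sectionAlg | α ∈ domElts C.sectionAlg ∧ C.one x ∈ α.1} := by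
  refine isDomUltrafilter_of (fun α h => h.1) ?_ ?_ ?_ ?_ ?_
  · exact ⟨_, idSec_mem_domElts Set.univ isClopen_univ, one_mem_one_image.2 trivial⟩
  · rintro α ⟨hα, h1⟩ β ⟨hβ, h2⟩
    refine ⟨comp_mem_domElts hα hβ, ?_⟩
    obtain ⟨V, hV, hαV⟩ := exists_of_mem_domElts hα
    rw [coe_comp, hαV, setComp_one_image]
    rw [hαV, one_mem_one_image] at h1
    exact ⟨h2, (C.src_one x).symm ▸ h1⟩
  · rintro α ⟨hα, h1⟩ β hβ h
    exact ⟨hβ, le_iff.1 h h1⟩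
  · rintro ⟨-, h⟩
    exact Set.notMem_empty _ (coe_zero ▸ h)
  · intro α hα
    obtain ⟨V, hV, hαV⟩ := exists_of_mem_domElts hα
    by_cases h : x ∈ V
    · exact Or.inl ⟨hα, hαV ▸ one_mem_one_image.2 h⟩
    · refine Or.inr ⟨antidom_mem α, mem_setAntidom.2 ?_⟩
      rw [C.src_one, hαV, src_image_one]
      exact ⟨rfl, h⟩

/-- Downward directedness holds because clopen sections form a basis of the space of arrows. -/
theorem isPrimeFilter_mem (f : C.Arr) : IsPrimeFilter {S : C.sectionAlg | f ∈ S.1} := by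
  refine ⟨⟨fun _ _ => trivial, ?_, ?_, ?_⟩, ?_, ?_⟩
  · obtain ⟨S, hS, hf, -⟩ := exists_isClopenSection isOpen_univ (Set.mem_univ f)
    exact ⟨⟨S, hS⟩, hf⟩
  · exact fun S hS T _ h => le_iff.1 h hS
  · intro S hS T hT
    obtain ⟨R, hR, hf, hs⟩ := exists_isClopenSection
      ((isClopenSection_iff.1 S.2).1.inter (isClopenSection_iff.1 T.2).1) ⟨hS, hT⟩
    exact ⟨⟨R, hR⟩, hf, le_iff.2 fun g hg => (hs hg).1, le_iff.2 fun g hg => (hs hg).2⟩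
  · intro h
    have h0 : zero C.sectionAlg ∈ {S : C.sectionAlg | f ∈ S.1} := h ▸ trivial
    exact Set.notMem_empty f (coe_zero ▸ h0)
  · exact fun S T h => (mem_setPref.1 h).imp_right And.right

/-- The ultrafilter of clopen neighbourhoods of an object. -/
def objPoint (x : C.Obj) : DomUltrafilter C.sectionAlg := ⟨_, isDomUltrafilter_one_mem x⟩

/-- The prime filter of clopen sections through an arrow. -/
def arrPoint (f : C.Arr) : PrimeFilter C.sectionAlg := ⟨_, isPrimeFilter_mem f⟩

theorem src_arrPoint (f : C.Arr) : (arrPoint f).src = objPoint (C.src f) := by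
  refine Subtype.ext ((arrPoint f).src.2.eq_of_subset (objPoint (C.src f)).2 ?_)
  rintro _ ⟨S, hS, rfl⟩
  refine ⟨dom_mem S, ?_⟩
  rw [coe_dom]
  exact ⟨_, ⟨f, hS, rfl⟩, rfl⟩

theorem tgt_arrPoint (f : C.Arr) : (arrPoint f).tgt = objPoint (C.tgt f) := by
  refine Subtype.ext ((arrPoint f).tgt.2.eq_of_subset (objPoint (C.tgt f)).2 ?_)
  rintro β ⟨hβ, _, ⟨S, hS, rfl⟩, h⟩
  exact ⟨hβ, le_iff.1 h ⟨_, ⟨f, hS, rfl⟩, rfl⟩⟩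

theorem arrPoint_one (x : C.Obj) : arrPoint (C.one x) = PrimeFilter.one (objPoint x) := by
  obtain ⟨α, hα⟩ := (objPoint x).2.nonempty
  refine PrimeFilter.ext_of_mem ?_ (a := α) hα.2 (PrimeFilter.mem_one hα)
  rw [src_arrPoint, PrimeFilter.src_one, C.src_one]

theorem arrPoint_comp (f g : C.Arr) (h : C.tgt f = C.src g)
    (h' : (arrPoint f).tgt = (arrPoint g).src) :
    arrPoint (C.comp f g h) = PrimeFilter.comp (arrPoint f) (arrPoint g) h' := by
  obtain ⟨S, hS⟩ := (arrPoint f).2.filter.nonempty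
  obtain ⟨T, hT⟩ := (arrPoint g).2.filter.nonempty
  refine PrimeFilter.ext_of_mem ?_ (a := S ⬝ T) ⟨f, hS, g, hT, h, rfl⟩
    (PrimeFilter.comp_mem_comp h' hS hT)
  rw [src_arrPoint, PrimeFilter.src_comp, src_arrPoint, C.src_comp]

theorem idSec_mem_objPoint {V : Set C.Obj} (hV : IsClopen V) {x : C.Obj} :
    idSec V hV ∈ (objPoint x).1 ↔ x ∈ V :=
  (and_iff_right (idSec_mem_domElts V hV)).trans one_mem_one_image

theorem objPoint_injective : Function.Injective (objPoint (C := C)) := by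
  intro x y h
  by_contra hxy
  obtain ⟨V, hV, hx, hy⟩ := exists_isClopen_of_totally_separated hxy
  exact hy ((idSec_mem_objPoint hV).1 (h ▸ (idSec_mem_objPoint hV).2 hx))

/-- If `μ` comes from no object, every object has a neighbourhood avoided by some member of `μ`. By
compactness finitely many such members have empty intersection. -/
theorem objPoint_surjective : Function.Surjective (objPoint (C := C)) := by
  intro μ
  by_contra! hn
  have key : ∃ α ∈ μ.1, ∀ x ∈ Set.univ, C.one x ∉ α.1 := by
    refine isCompact_univ.induction_on (p := fun W => ∃ α ∈ μ.1, ∀ x ∈ W, C.one x ∉ α.1)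
      ?_ ?_ ?_ ?_
    · exact μ.2.nonempty.imp fun α hα => ⟨hα, fun _ h => h.elim⟩
    · exact fun V W hVW ⟨α, hα, h⟩ => ⟨α, hα, fun x hx => h x (hVW hx)⟩
    · rintro V W ⟨α, hα, h⟩ ⟨β, hβ, h'⟩
      refine ⟨_, μ.2.inter hα hβ, ?_⟩
      rintro x (hx | hx) hm
      · exact h x hx (le_iff.1 (comp_le_left (μ.2.subset hβ)) hm)
      · exact h' x hx (le_iff.1 (comp_le_of_mem (μ.2.subset hα) β) hm)
    · intro x _
      have hx : ¬ μ.1 ⊆ (objPoint x).1 := fun hs =>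
        hn x (Subtype.ext (μ.2.eq_of_subset (objPoint x).2 hs).symm)
      obtain ⟨α, hα, hx⟩ := Set.not_subset.1 hx
      obtain ⟨V, hV, hαV⟩ := exists_of_mem_domElts (μ.2.subset hα)
      have hxV : x ∈ Vᶜ := fun h => hx ⟨μ.2.subset hα, hαV ▸ one_mem_one_image.2 h⟩
      refine ⟨Vᶜ, mem_nhdsWithin_of_mem_nhds (hV.compl.isOpen.mem_nhds hxV), α, hα, ?_⟩
      intro y hy h
      rw [hαV, one_mem_one_image] at h
      exact hy h
  obtain ⟨α, hα, h⟩ := key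
  obtain ⟨V, hV, hαV⟩ := exists_of_mem_domElts (μ.2.subset hα)
  have hα0 : α = zero C.sectionAlg := by
    refine Subtype.ext (hαV.trans (Eq.trans ?_ coe_zero.symm))
    refine Set.eq_empty_of_forall_notMem ?_
    rintro _ ⟨x, hx, rfl⟩
    exact h x trivial (hαV ▸ ⟨x, hx, rfl⟩)
  exact μ.2.zero_notMem (hα0 ▸ hα)

theorem continuous_objPoint : Continuous (objPoint (C := C)) := by
  refine continuous_generateFrom_iff.2 ?_
  rintro _ ⟨α, hα, rfl⟩
  convert (isClopenSection_iff.1 α.2).1.preimage C.continuous_one using 1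
  exact Set.ext fun x => and_iff_right hα

theorem arrPoint_injective : Function.Injective (arrPoint (C := C)) := by
  intro f g h
  have hs : C.src f = C.src g := objPoint_injective (by rw [← src_arrPoint, h, src_arrPoint])
  obtain ⟨S, hS⟩ := (arrPoint f).2.filter.nonempty
  have hS' : S ∈ (arrPoint g).1 := h ▸ hS
  exact Sections.src_injOn S hS hS' hs

/-- A member `S` of `P` contains an arrow at the object defining the source of `P`; its filter
shares `S` and the source with `P`. -/
theorem arrPoint_surjective : Function.Surjective (arrPoint (C := C)) := by
  intro P
  obtain ⟨x, hx⟩ := objPoint_surjective P.src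
  obtain ⟨S, hS⟩ := P.2.filter.nonempty
  have hd : dom S ∈ (objPoint x).1 := hx ▸ PrimeFilter.dom_mem_src hS
  have hd' := hd.2
  rw [coe_dom, one_mem_one_image] at hd'
  obtain ⟨f, hf, rfl⟩ := hd'
  exact ⟨f, PrimeFilter.ext_of_mem ((src_arrPoint f).trans hx) hf hS⟩

theorem continuous_arrPoint : Continuous (arrPoint (C := C)) := by
  refine continuous_generateFrom_iff.2 ?_
  rintro _ ⟨S, rfl⟩
  exact (isClopenSection_iff.1 S.2).1

theorem isOpenMap_arrPoint : IsOpenMap (arrPoint (C := C)) := by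
  intro U hU
  refine isOpen_iff_forall_mem_open.2 ?_
  rintro _ ⟨f, hf, rfl⟩
  obtain ⟨S, hS, hfS, hSU⟩ := exists_isClopenSection hU hf
  let S' : C.sectionAlg := ⟨S, hS⟩
  refine ⟨{P | S' ∈ P.1}, ?_, PrimeFilter.isOpen_mem S', hfS⟩
  intro P hP
  obtain ⟨g, rfl⟩ := arrPoint_surjective P
  exact ⟨g, hSU hP, rfl⟩

/-- Objects correspond to ultrafilters. -/
noncomputable def objHomeomorph (C : StoneEtaleCat.{u}) :
    C.Obj ≃ₜ DomUltrafilter C.sectionAlg :=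
  Continuous.homeoOfEquivCompactToT2
    (f := Equiv.ofBijective objPoint ⟨objPoint_injective, objPoint_surjective⟩) continuous_objPoint

/-- Arrows correspond to prime filters. -/
noncomputable def arrHomeomorph (C : StoneEtaleCat.{u}) :
    C.Arr ≃ₜ PrimeFilter C.sectionAlg :=
  (Equiv.ofBijective arrPoint ⟨arrPoint_injective, arrPoint_surjective⟩).toHomeomorphOfContinuousOpen
    continuous_arrPoint isOpenMap_arrPoint

/-- A Stone étale category is isomorphic to the category of prime filters of its sections. -/
noncomputable def counitIso (C : StoneEtaleCat.{u}) : C ≅ primeFilterCat C.sectionAlg :=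
  isoOfHomeomorph (objHomeomorph C) (arrHomeomorph C) src_arrPoint tgt_arrPoint arrPoint_one
    arrPoint_comp

theorem preimage_objPoint (F : C ⟶ D) (x : C.Obj) :
    (objPoint x).preimage (sectionMap F) = objPoint (F.obj x) := by
  refine Subtype.ext (((objPoint x).preimage (sectionMap F)).2.eq_of_subset
    (objPoint (F.obj x)).2 ?_)
  rintro α ⟨hα, -, g, hg, h⟩
  refine ⟨hα, ?_⟩
  obtain ⟨V, -, hαV⟩ := exists_of_mem_domElts hα
  have hs := F.rel_src _ _ h
  rw [C.src_one] at hs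
  rw [hαV] at hg ⊢
  obtain ⟨y, hy, rfl⟩ := hg
  rw [D.src_one] at hs
  exact ⟨y, hy, congrArg _ hs⟩

/-- The inclusion provides an arrow related to `f` in a section `S` through `g`. Its source is that
of `g`, so it is `g`. -/
theorem arrPoint_subset_preimage_iff (F : C ⟶ D) (f : C.Arr) (g : D.Arr) :
    (arrPoint g).1 ⊆ (sectionMap F).toFun ⁻¹' (arrPoint f).1 ↔ F.rel f g := by
  refine ⟨fun h => ?_, fun h S hS => ⟨g, hS, h⟩⟩
  have hs := PrimeFilter.src_of_subset _ h
  rw [src_arrPoint, src_arrPoint, preimage_objPoint] at hs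
  obtain ⟨S, hS⟩ := (arrPoint g).2.filter.nonempty
  obtain ⟨g', hg', hf⟩ := h hS
  rwa [Sections.src_injOn S hS hg' ((objPoint_injective hs).trans (F.rel_src _ _ hf).symm)]

end Counit

/-- The counit of the equivalence. -/
noncomputable def counitNatIso : sectionFunctor ⋙ primeFilterFunctor ≅ 𝟭 StoneEtaleCat.{u} :=
  (NatIso.ofComponents (F := 𝟭 _) (G := sectionFunctor ⋙ primeFilterFunctor) counitIso
    (fun {C D} F => by
      apply StarCoherentFunctor.ext
      · exact funext fun x => (preimage_objPoint F x).symm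
      · funext f Q
        obtain ⟨g, rfl⟩ := arrPoint_surjective Q
        refine propext ⟨?_, ?_⟩
        · rintro ⟨g', h, h'⟩
          rw [arrPoint_injective h'] at h
          exact ⟨_, rfl, (arrPoint_subset_preimage_iff F f g).2 h⟩
        · rintro ⟨_, rfl, h⟩
          exact ⟨g, (arrPoint_subset_preimage_iff F f g).1 h, rfl⟩)).symm

end PartialFunctionDuality

theorem mainTheorem1 :
    ∃ e : PartialFunctionDuality.RepAlg.{u}ᵒᵖ ≌ PartialFunctionDuality.StoneEtaleCat.{u},
      PartialFunctionDuality.IsPrimeFilterFunctor e.functor ∧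
        PartialFunctionDuality.IsSectionFunctor e.inverse :=
  -- `Equivalence.mk` corrects the unit to satisfy the triangle identity and leaves both functors
  -- unchanged.
  ⟨.mk PartialFunctionDuality.primeFilterFunctor PartialFunctionDuality.sectionFunctor
    PartialFunctionDuality.unitNatIso PartialFunctionDuality.counitNatIso,
    PartialFunctionDuality.isPrimeFilterFunctor_primeFilterFunctor,
    PartialFunctionDuality.isSectionFunctor_sectionFunctor⟩
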